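/- Let $\sigma(s)=e^s/(1+e^s)$. For $c\in\mathbb R$ and an integer $n\ge 1$, let $K_{c,n}$ be the transition kernel on $\Omega_n=\{0,1/n,\dots,1\}$ given by $$K_{c,n}(x,\{x'\})=\binom{n}{nx'}\,\sigma(cx)^{nx'}\,[1-\sigma(cx)]^{n-nx'},\qquad x,x'\in\Omega_n,$$ i.e. given $X_t=x$, $X_{t+1}$ is distributed as $n^{-1}\mathrm{Bin}(n,\sigma(cx))$. (This is the chain of layer averages of the alternating Gibbs sampler for the restricted Boltzmann machine with $n$ visible and $n$ hidden nodes, zero biases and all weights equal to $c/n$.) Its stationary distribution $\pi_{c,n}$ is given by $\pi_{c,n}(\{x\})\propto\binom{n}{nx}(1+e^{cx})^n$, $x\in\Omega_n$. Let $$\tau(K_{c,n})=\max_{x\in\Omega_n}\inf\{t\ge 0:\ \|K_{c,n}^t(x,\cdot)-\pi_{c,n}\|_{\mathrm{TV}}<1/4\},\qquad \|P-Q\|_{\mathrm{TV}}=\sup_{A\subset\Omega_n}|P(A)-Q(A)|.$$ The equation $xe^x/(1+e^x)=1$ has a unique real solution $x_\star\approx 1.278$; put $c_\star=-1-x_\star-e^{x_\star}\approx-5.87$.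 Then: - If $c>c_\star$, then $\tau(K_{c,n})=O(\log n)$ as $n\to\infty$ (with a constant that may depend on $c$). - If $c<c_\star$, there is a constant $\psi_c>0$ such that $\tau(K_{c,n})\ge e^{\psi_c n}/8$ for all $n\ge1$. - If $c=c_\star$, then for every $\gamma\in(0,1/4)$ one has $\tau(K_{c,n})\ge 2n^\gamma$ for all sufficiently large $n$. - If $c=c_\star$, then $\tau(K_{c,n})=O(n^5)$ as $n\to\infty$. -/

import Mathlib

open Filter
open scoped ENNReal

noncomputable section

namespace RBM

/-- Total variation distance between two probability mass functions on a finite set: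
the supremum over events `A` of `|P(A) - Q(A)|`. -/
def tvDist {Ω : Type*} [Fintype Ω] (p q : Ω → ℝ) : ℝ :=
  ⨆ A : Finset Ω, |(∑ x ∈ A, p x) - (∑ x ∈ A, q x)|

/-- `p` is a probability mass function on a finite set. -/
def IsProb {Ω : Type*} [Fintype Ω] (p : Ω → ℝ) : Prop :=
  (∀ x, 0 ≤ p x) ∧ ∑ x, p x = 1

/-- `p` is a stationary distribution of the transition matrix `K`. -/
def IsStationary {Ω : Type*} [Fintype Ω] (K : Matrix Ω Ω ℝ) (p : Ω → ℝ) : Prop :=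
  IsProb p ∧ Matrix.vecMul p K = p

/-- The `ε`-mixing time of a finite Markov chain with transition matrix `K` and stationary
distribution `p`: the maximum over starting points `x` of the first time `t` at which
`K ^ t x` is within total variation distance `< ε` of `p` (it would be infinite if there
were no such time). -/
def mixingTime {Ω : Type*} [Fintype Ω] [DecidableEq Ω]
    (ε : ℝ) (K : Matrix Ω Ω ℝ) (p : Ω → ℝ) : ℕ∞ :=
  ⨆ x : Ω, ⨅ t ∈ {t : ℕ | tvDist ((K ^ t) x) p < ε}, (t : ℕ∞)

/-- The point `j / n` of the state space `{0, 1/n, …, 1}`; the index `j : Fin (n + 1)`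
stands for this point. -/
def pt (n : ℕ) (j : Fin (n + 1)) : ℝ := (j : ℝ) / (n : ℝ)

/-- The kernel of the reduced Gibbs chain: from `x = i / n`, the next state is `j / n` with
`j` binomial with parameters `n` and `σ(c x)`, where `σ(s) = 1 / (1 + exp (-s))`. -/
def gibbsK (c : ℝ) (n : ℕ) : Matrix (Fin (n + 1)) (Fin (n + 1)) ℝ :=
  fun i j => (n.choose j : ℝ) * Real.sigmoid (c * pt n i) ^ (j : ℕ)
    * (1 - Real.sigmoid (c * pt n i)) ^ (n - (j : ℕ))

/-- Unnormalized stationary weight `(n choose n x) (1 + exp (c x)) ^ n`, at `x = j / n`. -/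
def gibbsWeight (c : ℝ) (n : ℕ) (j : Fin (n + 1)) : ℝ :=
  (n.choose j : ℝ) * (1 + Real.exp (c * pt n j)) ^ n

/-- The stationary distribution of the reduced Gibbs chain. -/
def gibbsPi (c : ℝ) (n : ℕ) (j : Fin (n + 1)) : ℝ :=
  gibbsWeight c n j / ∑ i, gibbsWeight c n i

/-- The mixing time (at level `1/4`) of the reduced Gibbs chain. -/
def tau (c : ℝ) (n : ℕ) : ℕ∞ := mixingTime (1 / 4) (gibbsK c n) (gibbsPi c n)

/-- Every row of the kernel is a probability distribution. -/
theorem isProb_gibbsK (c : ℝ) (n : ℕ) (i : Fin (n + 1)) : IsProb (gibbsK c n i) := by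
  constructor
  · intro j
    have h1 := Real.sigmoid_nonneg (c * pt n i)
    have h2 : 0 ≤ 1 - Real.sigmoid (c * pt n i) := sub_nonneg.2 (Real.sigmoid_le_one _)
    unfold gibbsK
    positivity
  · have h := add_pow (Real.sigmoid (c * pt n i)) (1 - Real.sigmoid (c * pt n i)) n
    rw [add_sub_cancel, one_pow, ← Fin.sum_univ_eq_sum_range
      (fun m => Real.sigmoid (c * pt n i) ^ m * (1 - Real.sigmoid (c * pt n i)) ^ (n - m)
        * (n.choose m : ℝ))] at h
    rw [h]
    refine Finset.sum_congr rfl fun j _ => ?_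
    unfold gibbsK
    ring

theorem gibbsWeight_pos (c : ℝ) (n : ℕ) (j : Fin (n + 1)) : 0 < gibbsWeight c n j := by
  have h : 0 < n.choose j := Nat.choose_pos (Nat.lt_succ_iff.1 j.2)
  have h' : (0 : ℝ) < n.choose j := by exact_mod_cast h
  unfold gibbsWeight
  positivity

/-- Weight times kernel, in closed form. -/
theorem gibbsWeight_mul_gibbsK (c : ℝ) (n : ℕ) (i j : Fin (n + 1)) :
    gibbsWeight c n i * gibbsK c n i j
      = (n.choose i : ℝ) * (n.choose j : ℝ) * Real.exp (c * pt n i * j) := by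
  have hj : (j : ℕ) ≤ n := Nat.lt_succ_iff.1 j.2
  have he : 0 < Real.exp (c * pt n i) := Real.exp_pos _
  have hs : Real.sigmoid (c * pt n i)
      = Real.exp (c * pt n i) / (1 + Real.exp (c * pt n i)) := by
    rw [Real.sigmoid_def, Real.exp_neg]
    field_simp
    ring
  have hs' : 1 - Real.sigmoid (c * pt n i) = 1 / (1 + Real.exp (c * pt n i)) := by
    rw [hs]
    field_simp
    ring
  have hp : (1 + Real.exp (c * pt n i)) ^ n
      = (1 + Real.exp (c * pt n i)) ^ (j : ℕ) * (1 + Real.exp (c * pt n i)) ^ (n - (j : ℕ)) := by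
    rw [← pow_add, Nat.add_sub_cancel' hj]
  have hx : Real.exp (c * pt n i * j) = Real.exp (c * pt n i) ^ (j : ℕ) := by
    rw [← Real.exp_nat_mul, mul_comm]
  unfold gibbsWeight gibbsK
  rw [hs', hs, hp, hx, div_pow, div_pow, one_pow]
  field_simp

/-- The distribution `gibbsPi` is stationary for the kernel (by reversibility). -/
theorem isStationary_gibbsPi (c : ℝ) (n : ℕ) : IsStationary (gibbsK c n) (gibbsPi c n) := by
  have hZ : 0 < ∑ i, gibbsWeight c n i :=
    Finset.sum_pos (fun i _ => gibbsWeight_pos c n i) Finset.univ_nonempty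
  refine ⟨⟨fun x => (div_pos (gibbsWeight_pos c n x) hZ).le, ?_⟩, ?_⟩
  · unfold gibbsPi
    rw [← Finset.sum_div, div_self hZ.ne']
  · ext j
    have hrev : ∀ i, gibbsPi c n i * gibbsK c n i j = gibbsPi c n j * gibbsK c n j i := by
      intro i
      have hw : gibbsWeight c n i * gibbsK c n i j = gibbsWeight c n j * gibbsK c n j i := by
        rw [gibbsWeight_mul_gibbsK, gibbsWeight_mul_gibbsK]
        have : c * pt n i * j = c * pt n j * i := by
          unfold pt
          ring
        rw [this]
        ring
      unfold gibbsPi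
      rw [div_mul_eq_mul_div, hw, div_mul_eq_mul_div]
    show ∑ i, gibbsPi c n i * gibbsK c n i j = gibbsPi c n j
    rw [Finset.sum_congr rfl fun i _ => hrev i, ← Finset.mul_sum, (isProb_gibbsK c n j).2, mul_one]

end RBM

end

/-! Write f(x) = σ(cx) and Φ = f ∘ f. One step of the chain is f plus binomial noise of order
n^{-1/2}, so two steps follow Φ, whose derivative is `slope c x * slope c (f x)`. For c ≤ 0 the map
f is decreasing and Φ is increasing. The value of c decides whether Φ contracts everywhere or has a
repelling fixed point.

Upper bounds. Differentiating a binomial expectation in its success probability gives a binomial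
expectation of increments (`hasDerivAt_binE`). Hence two steps multiply the largest increment of a
test function on the lattice by at most sup Φ' plus a correction of order 1/n (`mean_slope_le`,
`abs_gibbsStep_gibbsStep_sub_le`). An indicator has increments at most 1, so after 2t steps the
total variation distance is at most nρ^t. For c > c_⋆ one has sup Φ' < 1
(`exists_slope_mul_slope_le`), which gives logarithmic mixing. At c_⋆, Φ' ≤ 1 with equality only
where f(x) is the fixed point of f (`mul_sub_mul_sigmoid_deriv_lt_one`). The 1/n correction is
negative there, so ρ ≤ 1 - const/n, and time 2n² already suffices.

Lower bounds. Put c = -s(1 + e^s); then x₀ = 1/(1 + e^s) is fixed by f and |f'(x₀)| = s e^s/(1 +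
e^s), which exceeds 1 exactly when s > x_⋆, that is, when c < c_⋆. Then Φ pushes points away from x₀
on both sides, and the lattice points on either side form traps left with exponentially small
probability. Disjoint traps cannot both have stationary mass above 1/2, so the chain started in a
light one is far from stationarity (`le_mixingTime_of_two_traps`). At c_⋆ the drift Φ(x) - x is O((x
- x₀)²), and traps whose boundaries move slowly towards x₀ survive for about n^γ steps. -/

namespace RBM

/-! ### Total variation, mixing times and traps for finite chains -/

section Markov

variable {Ω : Type*} [Fintype Ω]

theorem le_tvDist (p q : Ω → ℝ) (A : Finset Ω) :
    |(∑ x ∈ A, p x) - (∑ x ∈ A, q x)| ≤ tvDist p q :=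
  le_ciSup (f := fun A : Finset Ω => |(∑ x ∈ A, p x) - (∑ x ∈ A, q x)|)
    (Set.finite_range _).bddAbove A

theorem tvDist_le {p q : Ω → ℝ} {r : ℝ}
    (h : ∀ A : Finset Ω, |(∑ x ∈ A, p x) - (∑ x ∈ A, q x)| ≤ r) : tvDist p q ≤ r :=
  ciSup_le h

/-- Among functions with values in [0, 1], the indicator of {q ≤ p} maximizes the difference of
means. -/
theorem sum_sub_mul_le_tvDist (p q g : Ω → ℝ) (h0 : ∀ x, 0 ≤ g x) (h1 : ∀ x, g x ≤ 1) :
    ∑ x, (p x - q x) * g x ≤ tvDist p q := by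
  classical
  refine le_trans ?_ ((le_abs_self _).trans
    (le_tvDist p q (Finset.univ.filter fun x => q x ≤ p x)))
  rw [← Finset.sum_sub_distrib, Finset.sum_filter]
  refine Finset.sum_le_sum fun x _ => ?_
  split_ifs with h
  · exact mul_le_of_le_one_right (sub_nonneg.2 h) (h1 x)
  · exact mul_nonpos_of_nonpos_of_nonneg (by linarith) (h0 x)

theorem tvDist_comm (p q : Ω → ℝ) : tvDist p q = tvDist q p := by
  unfold tvDist
  simp only [abs_sub_comm]

theorem abs_sum_sub_mul_le_tvDist (p q g : Ω → ℝ) (h0 : ∀ x, 0 ≤ g x) (h1 : ∀ x, g x ≤ 1) :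
    |∑ x, (p x - q x) * g x| ≤ tvDist p q := by
  rw [abs_le]
  refine ⟨?_, sum_sub_mul_le_tvDist p q g h0 h1⟩
  have h := sum_sub_mul_le_tvDist q p g h0 h1
  rw [tvDist_comm, show ∑ x, (q x - p x) * g x = -∑ x, (p x - q x) * g x by
    rw [← Finset.sum_neg_distrib]; exact Finset.sum_congr rfl fun x _ => by ring] at h
  linarith

/-- A transition matrix does not increase the total variation distance. -/
theorem tvDist_vecMul_le {K : Matrix Ω Ω ℝ} (hK : ∀ x, IsProb (K x)) (p q : Ω → ℝ) :
    tvDist (Matrix.vecMul p K) (Matrix.vecMul q K) ≤ tvDist p q := by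
  refine tvDist_le fun A => ?_
  have h : (∑ y ∈ A, Matrix.vecMul p K y) - ∑ y ∈ A, Matrix.vecMul q K y
      = ∑ x, (p x - q x) * ∑ y ∈ A, K x y := by
    simp only [Matrix.vecMul, dotProduct]
    rw [Finset.sum_comm, Finset.sum_comm (s := A) (t := Finset.univ), ← Finset.sum_sub_distrib]
    refine Finset.sum_congr rfl fun x _ => ?_
    rw [← Finset.mul_sum, ← Finset.mul_sum]
    ring
  rw [h]
  refine abs_sum_sub_mul_le_tvDist p q _ (fun x => Finset.sum_nonneg fun y _ => (hK x).1 y)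
    fun x => ?_
  rw [← (hK x).2]
  exact Finset.sum_le_sum_of_subset_of_nonneg (Finset.subset_univ _) fun y _ _ => (hK x).1 y

variable [DecidableEq Ω]

theorem isProb_pow {K : Matrix Ω Ω ℝ} (hK : ∀ x, IsProb (K x)) (t : ℕ) (x : Ω) :
    IsProb ((K ^ t) x) := by
  induction t generalizing x with
  | zero =>
    refine ⟨fun y => ?_, ?_⟩
    · rw [pow_zero, Matrix.one_apply]; split_ifs <;> norm_num
    · simp [Matrix.one_apply]
  | succ t ih =>
    refine ⟨fun y => ?_, ?_⟩
    · rw [pow_succ, Matrix.mul_apply]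
      exact Finset.sum_nonneg fun z _ => mul_nonneg ((ih x).1 z) ((hK z).1 y)
    · simp only [pow_succ, Matrix.mul_apply]
      rw [Finset.sum_comm]
      simp only [← Finset.mul_sum, (hK _).2, mul_one, (ih x).2]

theorem pow_succ_row (K : Matrix Ω Ω ℝ) (t : ℕ) (x : Ω) :
    (K ^ (t + 1)) x = Matrix.vecMul ((K ^ t) x) K := by
  ext y
  rw [pow_succ, Matrix.mul_apply]
  rfl

theorem vecMul_pow_eq {K : Matrix Ω Ω ℝ} {p : Ω → ℝ} (h : Matrix.vecMul p K = p) (t : ℕ) :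
    Matrix.vecMul p (K ^ t) = p := by
  induction t with
  | zero => simp
  | succ t ih => rw [pow_succ, ← Matrix.vecMul_vecMul, ih, h]

/-- The distance to the stationary distribution is nonincreasing in time. -/
theorem antitone_tvDist_pow {K : Matrix Ω Ω ℝ} (hK : ∀ x, IsProb (K x)) {p : Ω → ℝ}
    (hp : Matrix.vecMul p K = p) (x : Ω) : Antitone fun t => tvDist ((K ^ t) x) p :=
  antitone_nat_of_succ_le fun t => by
    have h := tvDist_vecMul_le hK ((K ^ t) x) p
    rwa [hp, ← pow_succ_row] at h

/-- If the averages of indicators under `K ^ t` oscillate by at most `r` then the chain is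
within `r` of its stationary distribution. -/
theorem tvDist_pow_le_of_osc {K : Matrix Ω Ω ℝ} {p : Ω → ℝ} (hp : IsStationary K p)
    {t : ℕ} {r : ℝ} (h : ∀ (A : Finset Ω) (x y : Ω),
      |(∑ z ∈ A, (K ^ t) x z) - ∑ z ∈ A, (K ^ t) y z| ≤ r) (x : Ω) :
    tvDist ((K ^ t) x) p ≤ r := by
  refine tvDist_le fun A => ?_
  have h1 : ∑ z ∈ A, p z = ∑ y, p y * ∑ z ∈ A, (K ^ t) y z := by
    conv_lhs => rw [← vecMul_pow_eq hp.2 t]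
    simp only [Matrix.vecMul, dotProduct]
    rw [Finset.sum_comm]
    simp only [← Finset.mul_sum]
  have h2 : ∑ z ∈ A, (K ^ t) x z = ∑ y, p y * ∑ z ∈ A, (K ^ t) x z := by
    rw [← Finset.sum_mul, hp.1.2, one_mul]
  rw [h1, h2, ← Finset.sum_sub_distrib]
  refine (Finset.abs_sum_le_sum_abs _ _).trans ?_
  calc ∑ y, |p y * ∑ z ∈ A, (K ^ t) x z - p y * ∑ z ∈ A, (K ^ t) y z|
      ≤ ∑ y, p y * r := by
        refine Finset.sum_le_sum fun y _ => ?_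
        rw [← mul_sub, abs_mul, abs_of_nonneg (hp.1.1 y)]
        exact mul_le_mul_of_nonneg_left (h A x y) (hp.1.1 y)
    _ = r := by rw [← Finset.sum_mul, hp.1.2, one_mul]

theorem mixingTime_le {ε : ℝ} {K : Matrix Ω Ω ℝ} {p : Ω → ℝ} {t : ℕ}
    (h : ∀ x, tvDist ((K ^ t) x) p < ε) : mixingTime ε K p ≤ t :=
  iSup_le fun x => iInf₂_le (f := fun (t : ℕ) (_ : t ∈ {t | tvDist ((K ^ t) x) p < ε}) => (t : ℕ∞))
    t (h x)

/-- Since the distance is nonincreasing in time, one bad time t rules out every s ≤ t; hence the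
gain to t + 1. -/
theorem le_mixingTime {ε : ℝ} {K : Matrix Ω Ω ℝ} (hK : ∀ x, IsProb (K x)) {p : Ω → ℝ}
    (hp : Matrix.vecMul p K = p) {t : ℕ} {x : Ω} (h : ε ≤ tvDist ((K ^ t) x) p) :
    ((t + 1 : ℕ) : ℕ∞) ≤ mixingTime ε K p := by
  refine le_iSup_of_le x (le_iInf₂ fun s hs => ?_)
  rw [Nat.cast_le]
  by_contra hlt
  have h1 := antitone_tvDist_pow hK hp x (show s ≤ t by omega)
  exact absurd hs (not_lt.2 (h.trans h1))

/-- If a set `S k` is left for the complement of `S (k + 1)` with probability at most `ε`, the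
chain started in `S 0` is outside `S k` at time `k` with probability at most `k * ε`. -/
theorem escape_prob_le {P : Matrix Ω Ω ℝ} (hP : ∀ x, IsProb (P x)) {ε : ℝ}
    (S : ℕ → Finset Ω) (T : ℕ) (h : ∀ k < T, ∀ x ∈ S k, ∑ y ∈ (S (k + 1))ᶜ, P x y ≤ ε)
    {x₀ : Ω} (hx₀ : x₀ ∈ S 0) (hε : 0 ≤ ε) :
    ∀ k ≤ T, ∑ y ∈ (S k)ᶜ, (P ^ k) x₀ y ≤ k * ε := by
  intro k
  induction k with
  | zero =>
    intro _
    rw [Finset.sum_eq_zero]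
    · simp
    · intro y hy
      rw [pow_zero, Matrix.one_apply_ne]
      rintro rfl
      exact (Finset.mem_compl.1 hy) hx₀
  | succ k ih =>
    intro hk
    have hμ := isProb_pow hP k x₀
    have h1 : ∑ y ∈ (S (k + 1))ᶜ, (P ^ (k + 1)) x₀ y
        = ∑ x, (P ^ k) x₀ x * ∑ y ∈ (S (k + 1))ᶜ, P x y := by
      simp only [pow_succ, Matrix.mul_apply]
      rw [Finset.sum_comm]
      simp only [Finset.mul_sum]
    rw [h1, ← Finset.sum_add_sum_compl (S k)]
    have h2 : ∑ x ∈ S k, (P ^ k) x₀ x * ∑ y ∈ (S (k + 1))ᶜ, P x y ≤ ε := by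
      calc _ ≤ ∑ x ∈ S k, (P ^ k) x₀ x * ε := Finset.sum_le_sum fun x hx =>
            mul_le_mul_of_nonneg_left (h k (by omega) x hx) (hμ.1 x)
        _ ≤ 1 * ε := by
            rw [← Finset.sum_mul]
            refine mul_le_mul_of_nonneg_right ?_ hε
            rw [← hμ.2]
            exact Finset.sum_le_sum_of_subset_of_nonneg (Finset.subset_univ _) fun y _ _ => hμ.1 y
        _ = ε := one_mul _
    have h3 : ∑ x ∈ (S k)ᶜ, (P ^ k) x₀ x * ∑ y ∈ (S (k + 1))ᶜ, P x y
        ≤ ∑ x ∈ (S k)ᶜ, (P ^ k) x₀ x := Finset.sum_le_sum fun x _ => by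
      refine mul_le_of_le_one_right (hμ.1 x) ?_
      rw [← (hP x).2]
      exact Finset.sum_le_sum_of_subset_of_nonneg (Finset.subset_univ _) fun y _ _ => (hP x).1 y
    have h4 := ih (by omega)
    push_cast
    linarith

/-- Two disjoint sets, each nearly preserved by `K ^ 2`, force slow mixing. -/
theorem le_mixingTime_of_two_traps {K : Matrix Ω Ω ℝ} (hK : ∀ x, IsProb (K x)) {p : Ω → ℝ}
    (hp : IsStationary K p) {ε : ℝ} (hε : 0 ≤ ε) (S R : ℕ → Finset Ω) (T : ℕ)
    (hS : ∀ k < T, ∀ x ∈ S k, ∑ y ∈ (S (k + 1))ᶜ, (K ^ 2) x y ≤ ε)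
    (hR : ∀ k < T, ∀ x ∈ R k, ∑ y ∈ (R (k + 1))ᶜ, (K ^ 2) x y ≤ ε)
    {x₀ y₀ : Ω} (hx₀ : x₀ ∈ S 0) (hy₀ : y₀ ∈ R 0) (hd : Disjoint (S T) (R T))
    (hT : T * ε ≤ 1 / 4) :
    ((2 * T + 1 : ℕ) : ℕ∞) ≤ mixingTime (1 / 4) K p := by
  -- A trap of stationary mass at most 1/2 still holds the chain with probability at least 3/4 at
  -- time 2T, so it witnesses distance at least 1/4.
  have key : ∀ (U : ℕ → Finset Ω) (z : Ω), z ∈ U 0 →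
      (∀ k < T, ∀ x ∈ U k, ∑ y ∈ (U (k + 1))ᶜ, (K ^ 2) x y ≤ ε) → ∑ x ∈ U T, p x ≤ 1 / 2 →
      ((2 * T + 1 : ℕ) : ℕ∞) ≤ mixingTime (1 / 4) K p := by
    intro U z hz hU hpU
    refine le_mixingTime hK hp.2 (x := z) ?_
    have h1 := escape_prob_le (fun x => isProb_pow hK 2 x) U T hU hz hε T le_rfl
    rw [← pow_mul] at h1
    have h2 := Finset.sum_add_sum_compl (U T) ((K ^ (2 * T)) z)
    rw [(isProb_pow hK (2 * T) z).2] at h2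
    refine le_trans ?_ (le_tvDist _ _ (U T))
    refine le_trans ?_ (le_abs_self _)
    linarith
  have h : ∑ x ∈ S T, p x + ∑ x ∈ R T, p x ≤ 1 := by
    rw [← Finset.sum_union hd, ← hp.1.2]
    exact Finset.sum_le_sum_of_subset_of_nonneg (Finset.subset_univ _) fun y _ _ => hp.1.1 y
  rcases le_total (∑ x ∈ S T, p x) (1 / 2) with h1 | h1
  · exact key S x₀ hx₀ hS h1
  · exact key R y₀ hy₀ hR (by linarith)

end Markov

/-! ### Binomial expectations: moments, derivative in the parameter, tails -/

/-- The expectation of `g` under the binomial distribution with parameters `n` and `p`. -/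
noncomputable def binE (n : ℕ) (p : ℝ) (g : ℕ → ℝ) : ℝ :=
  ∑ ij ∈ Finset.HasAntidiagonal.antidiagonal n, (n.choose ij.1 : ℝ) * (p ^ ij.1 * (1 - p) ^ ij.2 * g ij.1)

theorem binE_zero (p : ℝ) (g : ℕ → ℝ) : binE 0 p g = g 0 := by
  simp [binE]

/-- Conditioning on one trial (Pascal's rule); this recursion drives the inductions for the moments
and the derivative. -/
theorem binE_succ (n : ℕ) (p : ℝ) (g : ℕ → ℝ) :
    binE (n + 1) p g = p * binE n p (fun k => g (k + 1)) + (1 - p) * binE n p g := by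
  unfold binE
  rw [Finset.sum_antidiagonal_choose_succ_mul (fun i j => p ^ i * (1 - p) ^ j * g i) n,
    Finset.mul_sum, Finset.mul_sum, add_comm]
  congr 1
  · refine Finset.sum_congr rfl fun ij hij => ?_
    rw [← Finset.HasAntidiagonal.mem_antidiagonal.1 hij, Nat.choose_symm_add]
    ring
  · exact Finset.sum_congr rfl fun ij _ => by ring

theorem binE_eq_sum_fin (n : ℕ) (p : ℝ) (g : ℕ → ℝ) :
    binE n p g = ∑ j : Fin (n + 1), (n.choose j : ℝ) * p ^ (j : ℕ) * (1 - p) ^ (n - (j : ℕ)) * g j := by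
  rw [binE, Finset.Nat.sum_antidiagonal_eq_sum_range_succ
    (fun i j => (n.choose i : ℝ) * (p ^ i * (1 - p) ^ j * g i)), Finset.sum_range]
  exact Finset.sum_congr rfl fun j _ => by ring

theorem binE_mono {n : ℕ} {p : ℝ} (h0 : 0 ≤ p) (h1 : p ≤ 1) {g h : ℕ → ℝ}
    (hgh : ∀ k ≤ n, g k ≤ h k) : binE n p g ≤ binE n p h := by
  unfold binE
  refine Finset.sum_le_sum fun ij hij => ?_
  have : 0 ≤ 1 - p := by linarith
  have := hgh ij.1 (by have := Finset.HasAntidiagonal.mem_antidiagonal.1 hij; omega)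
  gcongr

theorem binE_add (n : ℕ) (p : ℝ) (g h : ℕ → ℝ) :
    binE n p (fun k => g k + h k) = binE n p g + binE n p h := by
  unfold binE
  rw [← Finset.sum_add_distrib]
  exact Finset.sum_congr rfl fun _ _ => by ring

theorem binE_const_mul (n : ℕ) (p a : ℝ) (g : ℕ → ℝ) :
    binE n p (fun k => a * g k) = a * binE n p g := by
  unfold binE
  rw [Finset.mul_sum]
  exact Finset.sum_congr rfl fun _ _ => by ring

theorem binE_sub (n : ℕ) (p : ℝ) (g h : ℕ → ℝ) :
    binE n p (fun k => g k - h k) = binE n p g - binE n p h := by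
  unfold binE
  rw [← Finset.sum_sub_distrib]
  exact Finset.sum_congr rfl fun _ _ => by ring

theorem binE_const (n : ℕ) (p a : ℝ) : binE n p (fun _ => a) = a := by
  induction n with
  | zero => exact binE_zero _ _
  | succ n ih => rw [binE_succ, ih]; ring

theorem binE_id (n : ℕ) (p : ℝ) : binE n p (fun k => (k : ℝ)) = n * p := by
  induction n with
  | zero => simp [binE_zero]
  | succ n ih =>
    rw [binE_succ]
    push_cast
    rw [binE_add, binE_const, ih]
    ring

theorem binE_sq (n : ℕ) (p : ℝ) :
    binE n p (fun k => (k : ℝ) ^ 2) = n * p * (1 - p) + (n * p) ^ 2 := by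
  induction n with
  | zero => simp [binE_zero]
  | succ n ih =>
    rw [binE_succ, show (fun k : ℕ => ((k + 1 : ℕ) : ℝ) ^ 2)
      = fun k : ℕ => ((k : ℝ) ^ 2 + 2 * k) + 1 by ext k; push_cast; ring,
      binE_add, binE_add, binE_const_mul, binE_const, binE_id, ih]
    push_cast
    ring

theorem binE_exp (n : ℕ) (p s : ℝ) :
    binE n p (fun k => Real.exp (s * k)) = (1 - p + p * Real.exp s) ^ n := by
  induction n with
  | zero => simp [binE_zero]
  | succ n ih =>
    rw [binE_succ, show (fun k : ℕ => Real.exp (s * ((k + 1 : ℕ) : ℝ)))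
      = fun k : ℕ => Real.exp s * Real.exp (s * k) by
        ext k; rw [← Real.exp_add]; push_cast; ring_nf,
      binE_const_mul, ih]
    ring

/-- Raising the parameter infinitesimally flips one of the n + 1 trials while the other n stay put.
This converts increments of g into the smoothness of its average. -/
theorem hasDerivAt_binE (n : ℕ) (p : ℝ) (g : ℕ → ℝ) :
    HasDerivAt (fun q => binE (n + 1) q g)
      ((n + 1) * binE n p (fun k => g (k + 1) - g k)) p := by
  induction n generalizing g with
  | zero =>
    have e : (fun q => binE (0 + 1) q g) = fun q => q * g (0 + 1) + (1 - q) * g 0 := by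
      ext q; rw [binE_succ, binE_zero, binE_zero]
    rw [e, binE_zero]
    have h := ((hasDerivAt_id p).mul_const (g (0 + 1))).add
      (((hasDerivAt_const p (1 : ℝ)).sub (hasDerivAt_id p)).mul_const (g 0))
    refine h.congr_deriv ?_
    push_cast
    ring
  | succ n ih =>
    have h1 := ih (fun k => g (k + 1))
    have h2 := ih g
    have h := ((hasDerivAt_id p).mul h1).add
      (((hasDerivAt_const p (1 : ℝ)).sub (hasDerivAt_id p)).mul h2)
    have e : (fun q => binE (n + 1 + 1) q g)
        = fun q => q * binE (n + 1) q (fun k => g (k + 1)) + (1 - q) * binE (n + 1) q g := by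
      ext q; exact binE_succ _ _ _
    rw [e]
    refine h.congr_deriv ?_
    simp only [id, Pi.sub_apply]
    rw [binE_succ n p (fun k => g (k + 1) - g k)]
    have e2 := binE_sub (n + 1) p (fun k => g (k + 1)) g
    rw [binE_succ n p (fun k => g (k + 1) - g k)] at e2
    push_cast
    linear_combination -e2

theorem abs_binE_le {n : ℕ} {p : ℝ} (h0 : 0 ≤ p) (h1 : p ≤ 1) {g d : ℕ → ℝ}
    (h : ∀ k ≤ n, |g k| ≤ d k) : |binE n p g| ≤ binE n p d := by
  rw [abs_le]
  constructor
  · have := binE_mono h0 h1 (g := fun k => (-1) * d k) (h := g)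
      (fun k hk => by linarith [(abs_le.1 (h k hk)).1])
    rw [binE_const_mul] at this
    linarith
  · exact binE_mono h0 h1 fun k hk => (abs_le.1 (h k hk)).2

/-- A crude bound for the Bernoulli moment generating function, from e^s ≤ 1 + s + s² on [-1, 1]. -/
theorem one_add_mul_exp_sub_one_le {p s : ℝ} (h0 : 0 ≤ p) (h1 : p ≤ 1) (hs : |s| ≤ 1) :
    1 - p + p * Real.exp s ≤ Real.exp (p * s + s ^ 2) := by
  have h2 := (abs_le.1 (Real.abs_exp_sub_one_sub_id_le hs)).2
  have h3 := Real.add_one_le_exp (p * s + s ^ 2)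
  nlinarith [sq_nonneg s, mul_le_mul_of_nonneg_left h2 h0]

/-- One-sided exponential tail bound for the binomial distribution. -/
theorem binE_tail {n : ℕ} (hn : 1 ≤ n) {p η s : ℝ} (h0 : 0 ≤ p) (h1 : p ≤ 1) (hη0 : 0 ≤ η)
    (hη : η ≤ 1) (hs : s = 1 ∨ s = -1) {g : ℕ → ℝ} (hg1 : ∀ k, g k ≤ 1)
    (hg0 : ∀ k : ℕ, s * ((k : ℝ) / n - p) < η → g k ≤ 0) :
    binE n p g ≤ Real.exp (-(n * η ^ 2 / 4)) := by
  have hn' : (0 : ℝ) < n := by exact_mod_cast hn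
  have hs2 : s ^ 2 = 1 := by rcases hs with rfl | rfl <;> norm_num
  have hsa : |s| = 1 := by rcases hs with rfl | rfl <;> norm_num
  -- Chernoff's method with tilt λ = η/2, which minimizes the resulting exponent n(λ² - λη).
  have h2 : ∀ k ≤ n, g k
      ≤ Real.exp (-(n * (η / 2) * (s * p + η))) * Real.exp (s * (η / 2) * k) := by
    intro k _
    rw [← Real.exp_add]
    by_cases h : s * ((k : ℝ) / n - p) < η
    · exact (hg0 k h).trans (Real.exp_pos _).le
    · refine (hg1 k).trans (Real.one_le_exp ?_)
      have e : -(n * (η / 2) * (s * p + η)) + s * (η / 2) * k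
          = n * (η / 2) * (s * ((k : ℝ) / n - p) - η) := by
        field_simp
        ring
      rw [e]
      have : 0 ≤ s * ((k : ℝ) / n - p) - η := by linarith
      positivity
  refine (binE_mono h0 h1 h2).trans ?_
  rw [binE_const_mul, binE_exp]
  have h3 : (1 - p + p * Real.exp (s * (η / 2))) ^ n
      ≤ Real.exp (p * (s * (η / 2)) + (s * (η / 2)) ^ 2) ^ n := by
    have : 0 ≤ 1 - p := by linarith
    refine pow_le_pow_left₀ (by positivity) (one_add_mul_exp_sub_one_le h0 h1 ?_) n
    rw [abs_mul, hsa, one_mul, abs_of_nonneg (by linarith)]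
    linarith
  rw [← Real.exp_nat_mul] at h3
  refine (mul_le_mul_of_nonneg_left h3 (Real.exp_pos _).le).trans ?_
  rw [← Real.exp_add]
  apply Real.exp_le_exp.2
  rw [mul_pow, hs2]
  apply le_of_eq
  ring

/-- Two-sided exponential tail bound for the binomial distribution. -/
theorem binE_tail_two_sided {n : ℕ} (hn : 1 ≤ n) {p η : ℝ} (h0 : 0 ≤ p) (h1 : p ≤ 1)
    (hη0 : 0 ≤ η) (hη : η ≤ 1) {g : ℕ → ℝ} (hg1 : ∀ k, g k ≤ 1)
    (hg0 : ∀ k : ℕ, |(k : ℝ) / n - p| < η → g k ≤ 0) :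
    binE n p g ≤ 2 * Real.exp (-(n * η ^ 2 / 4)) := by
  classical
  let g1 : ℕ → ℝ := fun k => if 1 * ((k : ℝ) / n - p) < η then 0 else 1
  let g2 : ℕ → ℝ := fun k => if (-1) * ((k : ℝ) / n - p) < η then 0 else 1
  have e1 : binE n p g1 ≤ Real.exp (-(n * η ^ 2 / 4)) :=
    binE_tail hn h0 h1 hη0 hη (Or.inl rfl) (fun k => by simp only [g1]; split_ifs <;> norm_num)
      (fun k hk => by simp only [g1, if_pos hk, le_refl])
  have e2 : binE n p g2 ≤ Real.exp (-(n * η ^ 2 / 4)) :=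
    binE_tail hn h0 h1 hη0 hη (Or.inr rfl) (fun k => by simp only [g2]; split_ifs <;> norm_num)
      (fun k hk => by simp only [g2, if_pos hk, le_refl])
  have e3 : binE n p g ≤ binE n p (fun k => g1 k + g2 k) := by
    refine binE_mono h0 h1 fun k _ => ?_
    by_cases ha : 1 * ((k : ℝ) / n - p) < η
    · by_cases hb : (-1) * ((k : ℝ) / n - p) < η
      · simp only [g1, g2, if_pos ha, if_pos hb, add_zero]
        exact hg0 k (abs_lt.2 ⟨by linarith, by linarith⟩)
      · simp only [g1, g2, if_pos ha, if_neg hb, zero_add]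
        exact hg1 k
    · have := hg1 k
      simp only [g1, g2, if_neg ha]
      split_ifs <;> linarith
  rw [binE_add] at e3
  linarith

/-! ### Taylor bounds for the sigmoid -/

theorem hasDerivAt_sigmoid_deriv (z : ℝ) :
    HasDerivAt (fun z => Real.sigmoid z * (1 - Real.sigmoid z))
      (Real.sigmoid z * (1 - Real.sigmoid z) * (1 - 2 * Real.sigmoid z)) z := by
  have h := (Real.hasDerivAt_sigmoid z).mul ((hasDerivAt_const z (1 : ℝ)).sub
    (Real.hasDerivAt_sigmoid z))
  refine h.congr_deriv ?_
  simp only [Pi.sub_apply]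
  ring

theorem hasDerivAt_sigmoid_deriv_deriv (z : ℝ) :
    HasDerivAt (fun z => Real.sigmoid z * (1 - Real.sigmoid z) * (1 - 2 * Real.sigmoid z))
      (Real.sigmoid z * (1 - Real.sigmoid z)
        * (1 - 6 * (Real.sigmoid z * (1 - Real.sigmoid z)))) z := by
  have h := (hasDerivAt_sigmoid_deriv z).mul ((hasDerivAt_const z (1 : ℝ)).sub
    ((Real.hasDerivAt_sigmoid z).const_mul 2))
  refine h.congr_deriv ?_
  simp only [Pi.sub_apply]
  ring

/-- Quadratic upper bound for the derivative of the sigmoid, from `σ''' ≤ 1 / 24`. -/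
theorem sigmoid_deriv_le (w z : ℝ) :
    Real.sigmoid z * (1 - Real.sigmoid z) ≤ Real.sigmoid w * (1 - Real.sigmoid w)
      + Real.sigmoid w * (1 - Real.sigmoid w) * (1 - 2 * Real.sigmoid w) * (z - w)
      + (z - w) ^ 2 / 48 := by
  set A := Real.sigmoid w * (1 - Real.sigmoid w) with hA
  set B := Real.sigmoid w * (1 - Real.sigmoid w) * (1 - 2 * Real.sigmoid w) with hB
  let h : ℝ → ℝ := fun z => A + B * (z - w) + (z - w) ^ 2 / 48
    - Real.sigmoid z * (1 - Real.sigmoid z)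
  let h' : ℝ → ℝ := fun z => B + (z - w) / 24
    - Real.sigmoid z * (1 - Real.sigmoid z) * (1 - 2 * Real.sigmoid z)
  have d1 : ∀ z, HasDerivAt h (h' z) z := fun z => by
    have e := (((((hasDerivAt_id z).sub_const w).const_mul B).const_add A).add
      ((((hasDerivAt_id z).sub_const w).pow 2).div_const 48)).sub (hasDerivAt_sigmoid_deriv z)
    refine e.congr_deriv ?_
    simp only [h', id]
    ring
  have d2 : ∀ z, HasDerivAt h' (1 / 24 - Real.sigmoid z * (1 - Real.sigmoid z)
        * (1 - 6 * (Real.sigmoid z * (1 - Real.sigmoid z)))) z := fun z =>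
    ((((hasDerivAt_id z).sub_const w).div_const 24).const_add B).sub
      (hasDerivAt_sigmoid_deriv_deriv z)
  have m : Monotone h' := monotone_of_deriv_nonneg (fun z => (d2 z).differentiableAt) fun z => by
    rw [(d2 z).deriv]
    -- With t = σ(1 - σ), the third derivative is t(1 - 6t), largest at t = 1/12 with value 1/24.
    nlinarith [sq_nonneg (Real.sigmoid z * (1 - Real.sigmoid z) - 1 / 12)]
  have hw : h w = 0 := by simp [h, hA]
  have hw' : h' w = 0 := by simp [h', hB]
  have hc : ∀ z, ContinuousAt h z := fun z => (d1 z).continuousAt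
  suffices 0 ≤ h z by simp only [h] at this; linarith
  rcases le_total w z with hz | hz
  · have : MonotoneOn h (Set.Ici w) := monotoneOn_of_deriv_nonneg (convex_Ici w)
      (fun x _ => (hc x).continuousWithinAt)
      (fun x _ => (d1 x).differentiableAt.differentiableWithinAt) fun x hx => by
        rw [(d1 x).deriv, ← hw']
        exact m (interior_subset hx)
    rw [← hw]
    exact this Set.self_mem_Ici hz hz
  · have : AntitoneOn h (Set.Iic w) := antitoneOn_of_deriv_nonpos (convex_Iic w)
      (fun x _ => (hc x).continuousWithinAt)
      (fun x _ => (d1 x).differentiableAt.differentiableWithinAt) fun x hx => by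
        rw [(d1 x).deriv, ← hw']
        have hx' : x ∈ Set.Iic w := interior_subset hx
        exact m hx'
    rw [← hw]
    exact this hz Set.self_mem_Iic hz

/-- Integrated form of `sigmoid_deriv_le`. Expanding about an arbitrary w lets every lattice cell be
compared with the binomial mean. -/
theorem sigmoid_sub_le {z₁ z₂ : ℝ} (hz : z₁ ≤ z₂) (w : ℝ) :
    Real.sigmoid z₂ - Real.sigmoid z₁ ≤ Real.sigmoid w * (1 - Real.sigmoid w) * (z₂ - z₁)
      + Real.sigmoid w * (1 - Real.sigmoid w) * (1 - 2 * Real.sigmoid w)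
        * ((z₂ - w) ^ 2 - (z₁ - w) ^ 2) / 2
      + ((z₂ - w) ^ 3 - (z₁ - w) ^ 3) / 144 := by
  set A := Real.sigmoid w * (1 - Real.sigmoid w) with hA
  set B := A * (1 - 2 * Real.sigmoid w) with hB
  let S : ℝ → ℝ := fun z => A * z + B * (z - w) ^ 2 / 2 + (z - w) ^ 3 / 144 - Real.sigmoid z
  have d : ∀ z, HasDerivAt S (A + B * (z - w) + (z - w) ^ 2 / 48
      - Real.sigmoid z * (1 - Real.sigmoid z)) z := fun z => by
    have e := ((((hasDerivAt_id z).const_mul A).add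
      (((((hasDerivAt_id z).sub_const w).pow 2).const_mul B).div_const 2)).add
      ((((hasDerivAt_id z).sub_const w).pow 3).div_const 144)).sub (Real.hasDerivAt_sigmoid z)
    refine e.congr_deriv ?_
    simp only [id]
    ring
  have m : Monotone S := monotone_of_deriv_nonneg (fun z => (d z).differentiableAt) fun z => by
    rw [(d z).deriv]
    linarith [sigmoid_deriv_le w z]
  have := m hz
  simp only [S] at this
  linarith

theorem abs_sigmoid_mul_sub_le (c w : ℝ) {x₁ x₂ : ℝ} (hx : x₁ ≤ x₂) :
    |Real.sigmoid (c * x₂) - Real.sigmoid (c * x₁)|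
      ≤ |c| * (Real.sigmoid (c * w) * (1 - Real.sigmoid (c * w)) * (x₂ - x₁))
      + |c| * c * (Real.sigmoid (c * w) * (1 - Real.sigmoid (c * w))
          * (1 - 2 * Real.sigmoid (c * w)) * ((x₂ - w) ^ 2 - (x₁ - w) ^ 2) / 2)
      + |c| * c ^ 2 * (((x₂ - w) ^ 3 - (x₁ - w) ^ 3) / 144) := by
  rcases le_total 0 c with hc | hc
  · have h := mul_le_mul_of_nonneg_left hx hc
    rw [abs_of_nonneg (sub_nonneg.2 (Real.sigmoid_le h)), abs_of_nonneg hc]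
    refine (sigmoid_sub_le h (c * w)).trans (le_of_eq ?_)
    ring
  · have h := mul_le_mul_of_nonpos_left hx hc
    rw [abs_sub_comm, abs_of_nonneg (sub_nonneg.2 (Real.sigmoid_le h)), abs_of_nonpos hc]
    refine (sigmoid_sub_le h (c * w)).trans (le_of_eq ?_)
    ring

/-! ### Contraction of lattice increments over two steps -/

/-- The absolute value of the derivative of `x ↦ σ (c x)`. -/
noncomputable def slope (c x : ℝ) : ℝ :=
  |c| * (Real.sigmoid (c * x) * (1 - Real.sigmoid (c * x)))

/-- The coefficient of `1 / n` in the bound for the mean slope. -/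
noncomputable def slopeCorr (c p : ℝ) : ℝ :=
  |c| * c * (Real.sigmoid (c * p) * (1 - Real.sigmoid (c * p)) * (1 - 2 * Real.sigmoid (c * p)))
    * (1 / 2 - p) + |c| * c ^ 2 / 48 * (p * (1 - p))

theorem slope_nonneg (c x : ℝ) : 0 ≤ slope c x := by
  have h1 := Real.sigmoid_nonneg (c * x)
  have h2 : 0 ≤ 1 - Real.sigmoid (c * x) := sub_nonneg.2 (Real.sigmoid_le_one _)
  unfold slope
  positivity

theorem slope_le (c x : ℝ) : slope c x ≤ |c| / 4 := by
  unfold slope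
  nlinarith [mul_nonneg (abs_nonneg c) (sq_nonneg (Real.sigmoid (c * x) - 1 / 2))]

theorem hasDerivAt_sigmoid_mul (c x : ℝ) :
    HasDerivAt (fun x => Real.sigmoid (c * x))
      (c * (Real.sigmoid (c * x) * (1 - Real.sigmoid (c * x)))) x := by
  have h := (Real.hasDerivAt_sigmoid (c * x)).comp x ((hasDerivAt_id x).const_mul c)
  refine h.congr_deriv ?_
  ring

/-- The mean slope of `x ↦ σ (c x)` over the lattice cells seen by a binomial variable. -/
theorem mean_slope_le (c : ℝ) (m : ℕ) {p : ℝ} (h0 : 0 ≤ p) (h1 : p ≤ 1) :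
    ((m : ℝ) + 1) * binE m p (fun k => |Real.sigmoid (c * (((k + 1 : ℕ) : ℝ) / ((m : ℝ) + 1)))
        - Real.sigmoid (c * ((k : ℝ) / ((m : ℝ) + 1)))|)
      ≤ slope c p + slopeCorr c p / (m + 1) + |c| * c ^ 2 / 144 / (m + 1) ^ 2 := by
  have hn : (0 : ℝ) < (m : ℝ) + 1 := by positivity
  set n : ℝ := (m : ℝ) + 1 with hnd
  set A := |c| * (Real.sigmoid (c * p) * (1 - Real.sigmoid (c * p))) with hA
  set B := |c| * c * (Real.sigmoid (c * p) * (1 - Real.sigmoid (c * p))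
          * (1 - 2 * Real.sigmoid (c * p))) with hB
  set M := |c| * c ^ 2 with hM
  have hM0 : 0 ≤ M := by positivity
  -- The differences of cubes over a cell are quadratic in k, so only the first two binomial moments
  -- are needed.
  have hb : ∀ k ≤ m, |Real.sigmoid (c * (((k + 1 : ℕ) : ℝ) / n)) - Real.sigmoid (c * ((k : ℝ) / n))|
      ≤ ((A / n + B * (1 / n ^ 2 - 2 * p / n) / 2
            + M / 144 * (3 * p ^ 2 / n - 3 * p / n ^ 2 + 1 / n ^ 3))
          + (B / n ^ 2 + M / 144 * (3 / n ^ 3 - 6 * p / n ^ 2)) * (k : ℝ))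
          + M / 48 / n ^ 3 * (k : ℝ) ^ 2 := by
    intro k _
    refine (abs_sigmoid_mul_sub_le c p (x₁ := (k : ℝ) / n) (x₂ := ((k + 1 : ℕ) : ℝ) / n)
      ?_).trans (le_of_eq ?_)
    · push_cast
      gcongr
      linarith
    · push_cast
      rw [← hM]
      have e1 : |c| * (Real.sigmoid (c * p) * (1 - Real.sigmoid (c * p))
          * (((k : ℝ) + 1) / n - k / n)) = A * (((k : ℝ) + 1) / n - k / n) := by rw [hA]; ring
      have e2 : |c| * c * (Real.sigmoid (c * p) * (1 - Real.sigmoid (c * p))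
          * (1 - 2 * Real.sigmoid (c * p)) * ((((k : ℝ) + 1) / n - p) ^ 2 - (k / n - p) ^ 2) / 2)
          = B * ((((k : ℝ) + 1) / n - p) ^ 2 - (k / n - p) ^ 2) / 2 := by rw [hB]; ring
      rw [e1, e2]
      field_simp
      ring
  refine (mul_le_mul_of_nonneg_left (binE_mono h0 h1 hb) hn.le).trans ?_
  rw [binE_add, binE_add, binE_const, binE_const_mul, binE_const_mul, binE_id, binE_sq]
  have hm : (m : ℝ) = n - 1 := by rw [hnd]; ring
  have e : slope c p + slopeCorr c p / n + M / 144 / n ^ 2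
      = A + (B * (1 / 2 - p) + M / 48 * (p * (1 - p))) / n + M / 144 / n ^ 2 := by
    rw [slope, slopeCorr, ← hA, ← hB, ← hM]
  rw [e, hm, ← sub_nonneg]
  -- The computed mean falls below the claimed bound by exactly this nonnegative term of order
  -- n^{-2}.
  have e' : A + (B * (1 / 2 - p) + M / 48 * (p * (1 - p))) / n + M / 144 / n ^ 2
      - n * (((A / n + B * (1 / n ^ 2 - 2 * p / n) / 2
            + M / 144 * (3 * p ^ 2 / n - 3 * p / n ^ 2 + 1 / n ^ 3))
          + (B / n ^ 2 + M / 144 * (3 / n ^ 3 - 6 * p / n ^ 2)) * ((n - 1) * p))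
          + M / 48 / n ^ 3 * ((n - 1) * p * (1 - p) + ((n - 1) * p) ^ 2))
      = M / 24 * (p * (1 - p)) / n ^ 2 := by
    field_simp
    ring
  rw [e']
  have : 0 ≤ 1 - p := by linarith
  positivity

/-- The action of the kernel on functions of the lattice index. -/
noncomputable def gibbsStep (c : ℝ) (n : ℕ) (g : ℕ → ℝ) (k : ℕ) : ℝ :=
  binE n (Real.sigmoid (c * ((k : ℝ) / n))) g

theorem sum_gibbsK_mul (c : ℝ) (n : ℕ) (g : ℕ → ℝ) (i : Fin (n + 1)) :
    ∑ j, gibbsK c n i j * g j = gibbsStep c n g i := by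
  rw [gibbsStep, binE_eq_sum_fin]
  rfl

theorem sum_gibbsK_pow_mul (c : ℝ) (n : ℕ) (g : ℕ → ℝ) (t : ℕ) (i : Fin (n + 1)) :
    ∑ j, (gibbsK c n ^ t) i j * g j = ((gibbsStep c n)^[t] g) i := by
  induction t generalizing g with
  | zero => simp [Matrix.one_apply]
  | succ t ih =>
    rw [Function.iterate_succ_apply, ← ih]
    simp only [pow_succ, Matrix.mul_apply, Finset.sum_mul]
    rw [Finset.sum_comm]
    refine Finset.sum_congr rfl fun j _ => ?_
    rw [← sum_gibbsK_mul, Finset.mul_sum]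
    exact Finset.sum_congr rfl fun l _ => by ring

/-- Mean value inequality applied to `hasDerivAt_binE`. -/
theorem abs_binE_sub_le {m : ℕ} {g : ℕ → ℝ} {D : ℝ}
    (hg : ∀ k < m + 1, |g (k + 1) - g k| ≤ D) {p q : ℝ} (hp : p ∈ Set.Icc (0 : ℝ) 1)
    (hq : q ∈ Set.Icc (0 : ℝ) 1) :
    |binE (m + 1) q g - binE (m + 1) p g| ≤ ((m : ℝ) + 1) * D * |q - p| := by
  have h := (convex_Icc (0 : ℝ) 1).norm_image_sub_le_of_norm_hasDerivWithin_le
    (f := fun q => binE (m + 1) q g) (C := ((m : ℝ) + 1) * D)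
    (fun x _ => (hasDerivAt_binE m x g).hasDerivWithinAt) (fun x hx => by
      rw [Real.norm_eq_abs, abs_mul, abs_of_nonneg (by positivity : (0 : ℝ) ≤ (m : ℝ) + 1)]
      refine mul_le_mul_of_nonneg_left ?_ (by positivity)
      refine (abs_binE_le hx.1 hx.2 (d := fun _ => D) fun k hk => hg k (by omega)).trans ?_
      rw [binE_const]) hp hq
  simpa only [Real.norm_eq_abs] using h

theorem sigmoid_mem_Icc (z : ℝ) : Real.sigmoid z ∈ Set.Icc (0 : ℝ) 1 :=
  ⟨Real.sigmoid_nonneg z, Real.sigmoid_le_one z⟩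

/-- Two steps of the chain multiply the lattice Lipschitz constant by at most `ρ`. -/
theorem abs_gibbsStep_gibbsStep_sub_le {c : ℝ} {m : ℕ} {ρ : ℝ}
    (hρ : ∀ x ∈ Set.Icc (0 : ℝ) 1, slope c x * (slope c (Real.sigmoid (c * x))
      + slopeCorr c (Real.sigmoid (c * x)) / (m + 1) + |c| * c ^ 2 / 144 / (m + 1) ^ 2) ≤ ρ)
    {g : ℕ → ℝ} {D : ℝ} (hD : 0 ≤ D) (hg : ∀ k < m + 1, |g (k + 1) - g k| ≤ D) :
    ∀ k < m + 1, |gibbsStep c (m + 1) (gibbsStep c (m + 1) g) (k + 1)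
      - gibbsStep c (m + 1) (gibbsStep c (m + 1) g) k| ≤ D * ρ := by
  intro k hk
  have hn : (0 : ℝ) < (m : ℝ) + 1 := by positivity
  set u := gibbsStep c (m + 1) g with hu
  -- The cell-dependent difference of σ is kept here instead of a uniform bound: averaging it in the
  -- second step yields the product of slopes along the orbit, rather than the square of the largest
  -- slope.
  have hu1 : ∀ l ≤ m, |u (l + 1) - u l| ≤ ((m : ℝ) + 1) * D
      * |Real.sigmoid (c * (((l + 1 : ℕ) : ℝ) / ((m : ℝ) + 1)))
        - Real.sigmoid (c * ((l : ℝ) / ((m : ℝ) + 1)))| := by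
    intro l _
    have := abs_binE_sub_le hg (sigmoid_mem_Icc (c * ((l : ℝ) / ((m : ℝ) + 1))))
      (sigmoid_mem_Icc (c * (((l + 1 : ℕ) : ℝ) / ((m : ℝ) + 1))))
    simpa only [hu, gibbsStep, Nat.cast_add_one] using this
  have hd : ∀ x, HasDerivAt (fun x => binE (m + 1) (Real.sigmoid (c * x)) u)
      (((m : ℝ) + 1) * binE m (Real.sigmoid (c * x)) (fun k => u (k + 1) - u k)
        * (c * (Real.sigmoid (c * x) * (1 - Real.sigmoid (c * x))))) x := fun x =>
    HasDerivAt.comp x (h₂ := fun q => binE (m + 1) q u)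
      (hasDerivAt_binE m (Real.sigmoid (c * x)) u) (hasDerivAt_sigmoid_mul c x)
  have h := (convex_Icc (0 : ℝ) 1).norm_image_sub_le_of_norm_hasDerivWithin_le
    (f := fun x => binE (m + 1) (Real.sigmoid (c * x)) u) (C := ((m : ℝ) + 1) * (D * ρ))
    (fun x _ => (hd x).hasDerivWithinAt) (fun x hx => by
      have hs := sigmoid_mem_Icc (c * x)
      have h1 := abs_binE_le hs.1 hs.2 hu1
      rw [binE_const_mul] at h1
      have h2 := mean_slope_le c m hs.1 hs.2
      have h3 : |c * (Real.sigmoid (c * x) * (1 - Real.sigmoid (c * x)))| = slope c x := by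
        rw [slope, abs_mul, abs_of_nonneg (a := _ * _)
          (mul_nonneg hs.1 (sub_nonneg.2 hs.2))]
      rw [Real.norm_eq_abs, abs_mul, abs_mul, h3, abs_of_nonneg hn.le, mul_assoc]
      refine mul_le_mul_of_nonneg_left ?_ hn.le
      calc |binE m (Real.sigmoid (c * x)) fun k => u (k + 1) - u k| * slope c x
          ≤ (((m : ℝ) + 1) * D * binE m (Real.sigmoid (c * x)) fun l =>
              |Real.sigmoid (c * (((l + 1 : ℕ) : ℝ) / ((m : ℝ) + 1)))
                - Real.sigmoid (c * ((l : ℝ) / ((m : ℝ) + 1)))|) * slope c x :=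
            mul_le_mul_of_nonneg_right h1 (slope_nonneg c x)
        _ = D * (slope c x * (((m : ℝ) + 1) * binE m (Real.sigmoid (c * x)) fun l =>
              |Real.sigmoid (c * (((l + 1 : ℕ) : ℝ) / ((m : ℝ) + 1)))
                - Real.sigmoid (c * ((l : ℝ) / ((m : ℝ) + 1)))|)) := by ring
        _ ≤ D * ρ := mul_le_mul_of_nonneg_left
            ((mul_le_mul_of_nonneg_left h2 (slope_nonneg c x)).trans (hρ x hx)) hD)
    (x := (k : ℝ) / ((m : ℝ) + 1)) (y := ((k + 1 : ℕ) : ℝ) / ((m : ℝ) + 1))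
    ⟨by positivity, (div_le_one hn).2 (by exact_mod_cast hk.le)⟩
    ⟨by positivity, (div_le_one hn).2 (by exact_mod_cast hk)⟩
  have e : ((k + 1 : ℕ) : ℝ) / ((m : ℝ) + 1) - (k : ℝ) / ((m : ℝ) + 1) = 1 / ((m : ℝ) + 1) := by
    push_cast; ring
  rw [e, Real.norm_eq_abs, Real.norm_eq_abs, abs_of_pos (by positivity : (0:ℝ) < 1 / ((m:ℝ) + 1)),
    show ((m : ℝ) + 1) * (D * ρ) * (1 / ((m : ℝ) + 1)) = D * ρ by field_simp] at h
  simpa only [gibbsStep, Nat.cast_add_one] using h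

theorem abs_sub_le_of_increments {n : ℕ} {g : ℕ → ℝ} {D : ℝ} (hD : 0 ≤ D)
    (hg : ∀ k < n, |g (k + 1) - g k| ≤ D) {i j : ℕ} (hi : i ≤ n) (hj : j ≤ n) :
    |g i - g j| ≤ n * D := by
  have key : ∀ i d : ℕ, i + d ≤ n → |g (i + d) - g i| ≤ d * D := by
    intro i d
    induction d with
    | zero => simp
    | succ d ih =>
      intro h
      have h1 := ih (by omega)
      have h2 := hg (i + d) (by omega)
      have h3 := abs_sub_le (g (i + (d + 1))) (g (i + d)) (g i)
      rw [← add_assoc] at h3 ⊢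
      push_cast
      linarith
  have mono : ∀ d : ℕ, d ≤ n → (d : ℝ) * D ≤ n * D := fun d hd =>
    mul_le_mul_of_nonneg_right (by exact_mod_cast hd) hD
  rcases le_total i j with h | h
  · obtain ⟨d, rfl⟩ := Nat.exists_eq_add_of_le h
    rw [abs_sub_comm]
    exact (key i d hj).trans (mono d (by omega))
  · obtain ⟨d, rfl⟩ := Nat.exists_eq_add_of_le h
    exact (key j d hi).trans (mono d (by omega))

/-- Geometric bound for the distance to stationarity along even times. -/
theorem tvDist_gibbsK_pow_le {c : ℝ} {m : ℕ} {ρ : ℝ} (hρ0 : 0 ≤ ρ)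
    (hρ : ∀ x ∈ Set.Icc (0 : ℝ) 1, slope c x * (slope c (Real.sigmoid (c * x))
      + slopeCorr c (Real.sigmoid (c * x)) / (m + 1) + |c| * c ^ 2 / 144 / (m + 1) ^ 2) ≤ ρ)
    (t : ℕ) (i : Fin (m + 1 + 1)) :
    tvDist ((gibbsK c (m + 1) ^ (2 * t)) i) (gibbsPi c (m + 1)) ≤ ((m : ℝ) + 1) * ρ ^ t := by
  classical
  refine tvDist_pow_le_of_osc (isStationary_gibbsPi c (m + 1)) (fun A x y => ?_) i
  -- The indicator of A, viewed on ℕ; its increments are at most 1, which starts the geometric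
  -- decay.
  let g : ℕ → ℝ := fun k => if ∃ z ∈ A, (z : ℕ) = k then 1 else 0
  have hA : ∀ x, ∑ z ∈ A, (gibbsK c (m + 1) ^ (2 * t)) x z
      = ((gibbsStep c (m + 1))^[2 * t] g) x := by
    intro x
    rw [← sum_gibbsK_pow_mul, ← Finset.sum_filter_add_sum_filter_not Finset.univ (· ∈ A)]
    rw [Finset.filter_mem_eq_inter, Finset.univ_inter]
    rw [Finset.sum_eq_zero (s := Finset.univ.filter fun z => z ∉ A), add_zero]
    · refine Finset.sum_congr rfl fun z hz => ?_
      have : g z = 1 := if_pos ⟨z, hz, rfl⟩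
      rw [this, mul_one]
    · intro z hz
      have : g z = 0 := if_neg (by
        rintro ⟨w, hw, h⟩
        exact (Finset.mem_filter.1 hz).2 (Fin.ext h ▸ hw))
      rw [this, mul_zero]
  have hg : ∀ t, ∀ k < m + 1, |((gibbsStep c (m + 1))^[2 * t] g) (k + 1)
      - ((gibbsStep c (m + 1))^[2 * t] g) k| ≤ ρ ^ t := by
    intro t
    induction t with
    | zero =>
      intro k _
      simp only [mul_zero, Function.iterate_zero, id, pow_zero, g]
      split_ifs <;> norm_num
    | succ t ih =>
      have := abs_gibbsStep_gibbsStep_sub_le hρ (pow_nonneg hρ0 t) ih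
      rw [pow_succ, show 2 * (t + 1) = 2 * t + 1 + 1 by ring, Function.iterate_succ_apply',
        Function.iterate_succ_apply']
      exact this
  rw [hA, hA]
  have := abs_sub_le_of_increments (pow_nonneg hρ0 t) (hg t) (i := x) (j := y)
    (by omega) (by omega)
  simpa using this

/-! ### The critical parameter -/

/-- The defining equation x e^x = 1 + e^x is used in the form (x - 1)e^x = 1. The exponents are
halved so that short Taylor bounds apply on [0, 1]. -/
theorem exists_sub_one_mul_exp_eq_one :
    ∃ u : ℝ, 1.278 < u ∧ u < 1.2785 ∧ (u - 1) * Real.exp u = 1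
      ∧ 5.865 < 1 + u + Real.exp u ∧ 1 + u + Real.exp u < 5.875 := by
  have b1 : 3.588 < Real.exp 1.278 := by
    have h := Real.sum_le_exp_of_nonneg (x := 0.639) (by norm_num) 7
    have e : Real.exp 1.278 = Real.exp 0.639 ^ 2 := by
      rw [← Real.exp_nat_mul]; norm_num
    rw [e]
    simp only [Finset.sum_range_succ, Finset.sum_range_zero, Nat.factorial] at h
    norm_num at h
    have h' : (1.8944 : ℝ) ≤ Real.exp (639 / 1000) := le_trans (by norm_num) h
    norm_num
    nlinarith
  have b2 : Real.exp 1.278 < 3.597 := by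
    have h := Real.exp_bound' (x := 0.639) (by norm_num) (by norm_num) (n := 7) (by norm_num)
    have e : Real.exp 1.278 = Real.exp 0.639 ^ 2 := by
      rw [← Real.exp_nat_mul]; norm_num
    rw [e]
    simp only [Finset.sum_range_succ, Finset.sum_range_zero, Nat.factorial] at h
    norm_num at h
    have h' : Real.exp (639 / 1000) ≤ (1.8947 : ℝ) := le_trans h (by norm_num)
    norm_num
    nlinarith [Real.exp_pos (639 / 1000)]
  have b3 : 3.5908 < Real.exp 1.2785 := by
    have h := Real.sum_le_exp_of_nonneg (x := 0.63925) (by norm_num) 8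
    have e : Real.exp 1.2785 = Real.exp 0.63925 ^ 2 := by
      rw [← Real.exp_nat_mul]; norm_num
    rw [e]
    simp only [Finset.sum_range_succ, Finset.sum_range_zero, Nat.factorial] at h
    norm_num at h
    have h' : (1.895 : ℝ) ≤ Real.exp (2557 / 4000) := le_trans (by norm_num) h
    norm_num
    nlinarith
  have b4 : Real.exp 1.2785 < 3.5965 := by
    have h := Real.exp_bound' (x := 0.63925) (by norm_num) (by norm_num) (n := 7) (by norm_num)
    have e : Real.exp 1.2785 = Real.exp 0.63925 ^ 2 := by
      rw [← Real.exp_nat_mul]; norm_num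
    rw [e]
    simp only [Finset.sum_range_succ, Finset.sum_range_zero, Nat.factorial] at h
    norm_num at h
    have h' : Real.exp (2557 / 4000) ≤ (1.8953 : ℝ) := le_trans h (by norm_num)
    norm_num
    nlinarith [Real.exp_pos (2557 / 4000)]
  have hc : ContinuousOn (fun u : ℝ => (u - 1) * Real.exp u) (Set.Icc 1.278 1.2785) := by
    fun_prop
  obtain ⟨u, hu, he⟩ := intermediate_value_Ioo (by norm_num) hc
    (show (1 : ℝ) ∈ Set.Ioo _ _ from ⟨by norm_num at b2 ⊢; nlinarith, by norm_num at b3 ⊢; nlinarith⟩)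
  have m1 := Real.exp_lt_exp.2 hu.1
  have m2 := Real.exp_lt_exp.2 hu.2
  refine ⟨u, hu.1, hu.2, he, ?_, ?_⟩
  · have := hu.1
    linarith
  · have := hu.2
    linarith

theorem strictMonoOn_sub_one_mul_exp :
    StrictMonoOn (fun u : ℝ => (u - 1) * Real.exp u) (Set.Ici 1) := by
  intro x hx y _ hxy
  have h1 : (0 : ℝ) ≤ x - 1 := sub_nonneg.2 hx
  have h2 := Real.exp_lt_exp.2 hxy
  have h3 := Real.exp_pos y
  simp only
  nlinarith

theorem mul_exp_div_eq_one_iff {u : ℝ} (hu1 : 1 < u) (hu : (u - 1) * Real.exp u = 1) (x : ℝ) :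
    x * Real.exp x / (1 + Real.exp x) = 1 ↔ x = u := by
  have hx := Real.exp_pos x
  have e : x * Real.exp x / (1 + Real.exp x) = 1 ↔ (x - 1) * Real.exp x = 1 := by
    rw [div_eq_one_iff_eq (by positivity)]
    constructor <;> intro h <;> linarith
  rw [e]
  constructor
  · intro h
    have hx1 : 1 < x := by
      by_contra hle
      nlinarith
    exact strictMonoOn_sub_one_mul_exp.injOn hx1.le hu1.le (h.trans hu.symm)
  · rintro rfl
    exact hu

/-! ### Bounds for the derivative of the two-step map -/

theorem sigmoid_eq_exp_div (z : ℝ) : Real.sigmoid z = Real.exp z / (1 + Real.exp z) := by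
  rw [Real.sigmoid_def, Real.exp_neg]
  have := Real.exp_pos z
  field_simp
  ring

theorem sigmoid_deriv_eq (z : ℝ) :
    Real.sigmoid z * (1 - Real.sigmoid z) = Real.exp z / (1 + Real.exp z) ^ 2 := by
  rw [sigmoid_eq_exp_div]
  have := Real.exp_pos z
  field_simp
  ring

theorem sigmoid_deriv_neg (z : ℝ) :
    Real.sigmoid (-z) * (1 - Real.sigmoid (-z)) = Real.sigmoid z * (1 - Real.sigmoid z) := by
  rw [Real.sigmoid_neg]
  ring

theorem exp_le_convex_comb {w : ℝ} (h0 : 0 ≤ w) (h1 : w ≤ 1) (d : ℝ) :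
    Real.exp (w * d) ≤ (1 - w) + w * Real.exp d := by
  have e1 : Real.exp d = Real.exp (w * d) * Real.exp ((1 - w) * d) := by
    rw [← Real.exp_add]; ring_nf
  have e2 : (1 : ℝ) = Real.exp (w * d) * Real.exp (-(w * d)) := by
    rw [← Real.exp_add]; simp
  have h2 := Real.add_one_le_exp ((1 - w) * d)
  have h3 := Real.add_one_le_exp (-(w * d))
  have h4 := Real.exp_pos (w * d)
  have h5 : (1 - w) * (-(w * d) + 1) + w * ((1 - w) * d + 1)
      ≤ (1 - w) * Real.exp (-(w * d)) + w * Real.exp ((1 - w) * d) :=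
    add_le_add (mul_le_mul_of_nonneg_left h3 (by linarith)) (mul_le_mul_of_nonneg_left h2 h0)
  have h6 := mul_le_mul_of_nonneg_left h5 h4.le
  have h7 : (1 - w) + w * Real.exp d = Real.exp (w * d)
      * ((1 - w) * Real.exp (-(w * d)) + w * Real.exp ((1 - w) * d)) := by
    rw [e1]
    linear_combination (1 - w) * e2
  rw [h7]
  linarith

/-- At the critical parameter, the two-step derivative is at most one, with equality only at the
fixed point. -/
theorem mul_sub_mul_sigmoid_deriv_lt_one {u v : ℝ} (hu1 : 1 < u) (hu : (u - 1) * Real.exp u = 1)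
    (hv0 : 0 ≤ v) (hne : v ≠ u) :
    v * (1 + u + Real.exp u - v) * (Real.sigmoid v * (1 - Real.sigmoid v)) < 1 := by
  set E := Real.exp u with hE
  have hEpos : 0 < E := Real.exp_pos u
  have hu0 : 0 < u := by linarith
  have huE : u * E = 1 + E := by linarith
  have ha : 1 + u + E - v = u * E - (v - u) := by linarith
  have hv1 : v / u < Real.exp ((v - u) / u) := by
    have : (v - u) / u ≠ 0 := div_ne_zero (sub_ne_zero.2 hne) hu0.ne'
    refine lt_of_eq_of_lt ?_ (Real.add_one_lt_exp this)
    field_simp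
    ring
  have hv2 : (u * E - (v - u)) / (u * E) ≤ Real.exp (-(v - u) / (u * E)) := by
    refine le_of_eq_of_le ?_ (Real.add_one_le_exp _)
    field_simp
    ring
  have hprod : v * (1 + u + E - v) < u * (u * E) * Real.exp ((v - u) / u + -(v - u) / (u * E)) := by
    have h1 : v / u * ((u * E - (v - u)) / (u * E))
        < Real.exp ((v - u) / u) * Real.exp (-(v - u) / (u * E)) :=
      (mul_le_mul_of_nonneg_left hv2 (by positivity)).trans_lt
        (mul_lt_mul_of_pos_right hv1 (Real.exp_pos _))
    rw [← Real.exp_add] at h1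
    have h2 := mul_lt_mul_of_pos_left h1 (show 0 < u * (u * E) by positivity)
    refine lt_of_eq_of_lt ?_ h2
    rw [ha]
    field_simp
  have hw : Real.exp (v - u) = Real.exp v / E := by rw [Real.exp_sub]
  -- Convexity of exp with weight 1/u = E/(1 + E), which is where the equation for u enters.
  have hs : (1 + E) * Real.exp ((v - u) / u) ≤ 1 + Real.exp v := by
    have h1 := exp_le_convex_comb (w := 1 / u) (by positivity)
      ((div_le_one hu0).2 hu1.le) (v - u)
    have h2 := mul_le_mul_of_nonneg_left h1 (show 0 ≤ 1 + E by positivity)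
    refine le_of_eq_of_le ?_ (h2.trans (le_of_eq ?_))
    · ring_nf
    · rw [hw, ← huE]
      field_simp
      linear_combination huE
  have hs2 : (1 + E) ^ 2 * Real.exp ((v - u) / u + (v - u) / u) ≤ (1 + Real.exp v) ^ 2 := by
    have := pow_le_pow_left₀ (by positivity) hs 2
    rw [mul_pow, sq (Real.exp _), ← Real.exp_add] at this
    exact this
  have hvpos := Real.exp_pos v
  rw [sigmoid_deriv_eq, ← mul_div_assoc, div_lt_one (by positivity)]
  refine lt_of_lt_of_le (mul_lt_mul_of_pos_right hprod hvpos) (le_trans (le_of_eq ?_) hs2)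
  have hve : Real.exp v = E * Real.exp (v - u) := by rw [hw]; field_simp
  -- The exponents match because 1/u + 1/(uE) = 1.
  have hexp : (v - u) / u + -(v - u) / (u * E) + (v - u) = (v - u) / u + (v - u) / u := by
    have h3 : (1 : ℝ) / u + 1 / (u * E) = 1 := by
      field_simp
      linarith
    linear_combination (-(v - u)) * h3
  rw [hve, show u * (u * E) * Real.exp ((v - u) / u + -(v - u) / (u * E)) * (E * Real.exp (v - u))
      = (u * E) ^ 2 * (Real.exp ((v - u) / u + -(v - u) / (u * E)) * Real.exp (v - u)) by ring,
    ← Real.exp_add, hexp, huE]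

theorem slope_mul_slope (c x : ℝ) :
    slope c x * slope c (Real.sigmoid (c * x))
      = c ^ 2 * (Real.sigmoid (c * x) * (1 - Real.sigmoid (c * x)))
        * (Real.sigmoid (c * Real.sigmoid (c * x)) * (1 - Real.sigmoid (c * Real.sigmoid (c * x)))) := by
  unfold slope
  rw [← sq_abs c]
  ring

/-- The reciprocal of σ'(v) is 4 + 4 sinh²(v/2), and |sinh t| ≥ |t|. The quadratic decay is what
handles all c ≥ 0 at once. -/
theorem sigmoid_deriv_le_inv (v : ℝ) :
    Real.sigmoid v * (1 - Real.sigmoid v) ≤ 1 / (4 + v ^ 2) := by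
  have h1 := Real.exp_pos v
  have h2 : 4 + v ^ 2 ≤ (1 + Real.exp v) ^ 2 / Real.exp v := by
    have e : (1 + Real.exp v) ^ 2 / Real.exp v = 4 + 4 * Real.sinh (v / 2) ^ 2 := by
      have hc : Real.cosh v = 1 + 2 * Real.sinh (v / 2) ^ 2 := by
        have := Real.cosh_two_mul (v / 2)
        rw [Real.cosh_sq, show 2 * (v / 2) = v by ring] at this
        linarith
      have hc2 := Real.cosh_eq v
      rw [Real.exp_neg] at hc2
      have : (1 + Real.exp v) ^ 2 / Real.exp v = 2 + 2 * Real.cosh v := by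
        rw [hc2]
        field_simp
        ring
      rw [this, hc]
      ring
    have hs : (v / 2) ^ 2 ≤ Real.sinh (v / 2) ^ 2 := by
      rw [sq_le_sq]
      rcases le_total 0 (v / 2) with h | h
      · rw [abs_of_nonneg h]
        exact (Real.self_le_sinh_iff.2 h).trans (le_abs_self _)
      · rw [abs_of_nonpos h, ← abs_neg, ← Real.sinh_neg]
        exact (Real.self_le_sinh_iff.2 (by linarith)).trans (le_abs_self _)
    rw [e]
    linarith
  rw [sigmoid_deriv_eq]
  have := one_div_le_one_div_of_le (by positivity) h2
  rwa [one_div_div] at this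

/-- Above the critical value the two-step map is a uniform contraction. -/
theorem exists_slope_mul_slope_le {u c : ℝ} (hu1 : 1 < u) (hu : (u - 1) * Real.exp u = 1)
    (hc : -1 - u - Real.exp u < c) :
    ∃ ρ < 1, ∀ x ∈ Set.Icc (0 : ℝ) 1, slope c x * slope c (Real.sigmoid (c * x)) ≤ ρ := by
  rcases le_or_gt 0 c with h0 | h0
  · refine ⟨c ^ 2 / (16 + c ^ 2), (div_lt_one (by positivity)).2 (by linarith), fun x hx => ?_⟩
    rw [slope_mul_slope]
    set p := Real.sigmoid (c * x) with hp
    have hp2 : 1 / 2 ≤ p := by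
      have : Real.sigmoid 0 ≤ p := Real.sigmoid_le (mul_nonneg h0 hx.1)
      rw [Real.sigmoid_zero] at this
      linarith
    have h1 : p * (1 - p) ≤ 1 / 4 := by nlinarith [sq_nonneg (p - 1 / 2)]
    have h2 := sigmoid_deriv_le_inv (c * p)
    have h3 : 1 / (4 + (c * p) ^ 2) ≤ 1 / (4 + c ^ 2 / 4) := by
      apply one_div_le_one_div_of_le (by positivity)
      nlinarith [mul_le_mul_of_nonneg_left (show (1 / 4 : ℝ) ≤ p ^ 2 by nlinarith) (sq_nonneg c)]
    have h4 : 0 ≤ Real.sigmoid (c * p) * (1 - Real.sigmoid (c * p)) :=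
      mul_nonneg (Real.sigmoid_nonneg _) (sub_nonneg.2 (Real.sigmoid_le_one _))
    calc c ^ 2 * (p * (1 - p)) * (Real.sigmoid (c * p) * (1 - Real.sigmoid (c * p)))
        ≤ c ^ 2 * (1 / 4) * (1 / (4 + c ^ 2 / 4)) := by
          refine mul_le_mul (mul_le_mul_of_nonneg_left h1 (sq_nonneg c)) (h2.trans h3) h4
            (by positivity)
      _ = c ^ 2 / (16 + c ^ 2) := by field_simp; ring
  · set a := 1 + u + Real.exp u with ha
    have ha0 : 0 < a := by have := Real.exp_pos u; linarith
    refine ⟨-c / a, (div_lt_one ha0).2 (by linarith), fun x hx => ?_⟩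
    rw [slope_mul_slope]
    set p := Real.sigmoid (c * x) with hp
    have hpm := sigmoid_mem_Icc (c * x)
    rw [← hp] at hpm
    -- In this variable Φ' = v(-c - v)σ'(v). Replacing -c by a costs the factor -c/a < 1, leaving
    -- the critical inequality.
    set v := -c * p with hv
    have hv0 : 0 ≤ v := mul_nonneg (by linarith) hpm.1
    have hvc : v ≤ -c := mul_le_of_le_one_right (by linarith) hpm.2
    have hm : v * (a - v) * (Real.sigmoid v * (1 - Real.sigmoid v)) ≤ 1 := by
      by_cases hne : v = u
      · have huE : u * Real.exp u = 1 + Real.exp u := by linarith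
        have hep := Real.exp_pos u
        rw [hne, sigmoid_deriv_eq, ← huE, ha]
        have : 1 + u + Real.exp u - u = u * Real.exp u := by linarith
        rw [this]
        apply le_of_eq
        field_simp
      · exact (mul_sub_mul_sigmoid_deriv_lt_one hu1 hu hv0 hne).le
    have hs : 0 ≤ Real.sigmoid v * (1 - Real.sigmoid v) :=
      mul_nonneg (Real.sigmoid_nonneg _) (sub_nonneg.2 (Real.sigmoid_le_one _))
    have e : c * p = -v := by rw [hv]; ring
    rw [e, sigmoid_deriv_neg, show c ^ 2 * (p * (1 - p)) = v * (-c - v) by rw [hv]; ring]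
    have h1 : -c - v ≤ -c / a * (a - v) := by
      rw [div_mul_eq_mul_div, le_div_iff₀ ha0]
      nlinarith
    calc v * (-c - v) * (Real.sigmoid v * (1 - Real.sigmoid v))
        ≤ v * (-c / a * (a - v)) * (Real.sigmoid v * (1 - Real.sigmoid v)) :=
          mul_le_mul_of_nonneg_right (mul_le_mul_of_nonneg_left h1 hv0) hs
      _ = -c / a * (v * (a - v) * (Real.sigmoid v * (1 - Real.sigmoid v))) := by ring
      _ ≤ -c / a * 1 := mul_le_mul_of_nonneg_left hm (div_nonneg (by linarith) ha0.le)
      _ = -c / a := mul_one _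

/-! ### Upper bounds for the mixing time -/

theorem continuous_slopeCorr (c : ℝ) : Continuous (slopeCorr c) := by
  unfold slopeCorr
  have : Continuous fun p => Real.sigmoid (c * p) :=
    continuous_sigmoid.comp (continuous_const.mul continuous_id)
  fun_prop

theorem tau_le_of_tvDist_lt {c : ℝ} {n t : ℕ} {r : ℝ}
    (h : ∀ i, tvDist ((gibbsK c n ^ t) i) (gibbsPi c n) < 1 / 4) (hr : (t : ℝ) ≤ r) :
    (tau c n : ℝ≥0∞) ≤ ENNReal.ofReal r := by
  have h1 : (tau c n : ℝ≥0∞) ≤ ((t : ℕ∞) : ℝ≥0∞) := ENat.toENNReal_le.2 (mixingTime_le h)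
  rw [ENat.toENNReal_coe] at h1
  refine h1.trans ?_
  rw [← ENNReal.ofReal_natCast]
  exact ENNReal.ofReal_le_ofReal hr

/-- Logarithmic mixing when the two-step map is a uniform contraction. -/
theorem exists_tau_le_log {c ρ : ℝ} (hρ : ρ < 1)
    (h : ∀ x ∈ Set.Icc (0 : ℝ) 1, slope c x * slope c (Real.sigmoid (c * x)) ≤ ρ) :
    ∃ C : ℝ, ∀ᶠ n : ℕ in atTop, (tau c n : ℝ≥0∞) ≤ ENNReal.ofReal (C * Real.log n) := by
  obtain ⟨B, hB⟩ := isCompact_Icc.exists_bound_of_continuousOn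
    ((continuous_slopeCorr c).continuousOn (s := Set.Icc (0 : ℝ) 1))
  have hB0 : 0 ≤ B := (norm_nonneg _).trans (hB 0 ⟨le_rfl, zero_le_one⟩)
  have hρ0 : 0 ≤ ρ := (mul_nonneg (slope_nonneg _ _) (slope_nonneg _ _)).trans
    (h 0 ⟨le_rfl, zero_le_one⟩)
  set r := (1 + ρ) / 2 with hr
  have hr0 : 0 < r := by linarith
  have hr1 : r < 1 := by linarith
  have hl : 0 < -Real.log r := neg_pos.2 (Real.log_neg hr0 hr1)
  -- After about 3 log n / (-log r) double steps the bound n r^t is at most n^{-2}; the summand 2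
  -- pays for the ceiling, since log n ≥ 1 for n ≥ 3.
  refine ⟨6 / (-Real.log r) + 2, ?_⟩
  set W := |c| / 4 * (B + |c| * c ^ 2 / 144) with hW
  have hW0 : 0 ≤ W := by positivity
  filter_upwards [eventually_ge_atTop 3, eventually_ge_atTop ⌈W / ((1 - ρ) / 2)⌉₊] with n hn3 hnW
  obtain ⟨m, rfl⟩ : ∃ m, n = m + 1 := ⟨n - 1, by omega⟩
  have hn : (3 : ℝ) ≤ (m : ℝ) + 1 := by exact_mod_cast hn3
  have hnW' : W / ((m : ℝ) + 1) ≤ (1 - ρ) / 2 := by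
    have h1 : W / ((1 - ρ) / 2) ≤ (m : ℝ) + 1 := by
      have := (Nat.le_ceil (W / ((1 - ρ) / 2))).trans (Nat.cast_le.2 hnW)
      push_cast at this
      exact this
    rw [div_le_iff₀ (by linarith)] at h1 ⊢
    linarith
  have hcontr : ∀ x ∈ Set.Icc (0 : ℝ) 1, slope c x * (slope c (Real.sigmoid (c * x))
      + slopeCorr c (Real.sigmoid (c * x)) / (m + 1) + |c| * c ^ 2 / 144 / (m + 1) ^ 2) ≤ r := by
    intro x hx
    have h1 := h x hx
    have h2 := (le_abs_self _).trans (hB _ (sigmoid_mem_Icc (c * x)))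
    have h3 : slopeCorr c (Real.sigmoid (c * x)) / ((m : ℝ) + 1) ≤ B / (m + 1) := by gcongr
    have h4 : |c| * c ^ 2 / 144 / ((m : ℝ) + 1) ^ 2 ≤ |c| * c ^ 2 / 144 / (m + 1) := by
      apply div_le_div_of_nonneg_left (by positivity) (by positivity)
      nlinarith
    have h5 : slope c x * (B / (m + 1) + |c| * c ^ 2 / 144 / (m + 1)) ≤ W / ((m : ℝ) + 1) := by
      refine (mul_le_mul_of_nonneg_right (slope_le c x) (by positivity)).trans (le_of_eq ?_)
      rw [hW]
      ring
    have h6 := mul_le_mul_of_nonneg_left (add_le_add h3 h4) (slope_nonneg c x)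
    have : slope c x * (slope c (Real.sigmoid (c * x))
      + slopeCorr c (Real.sigmoid (c * x)) / (m + 1) + |c| * c ^ 2 / 144 / (m + 1) ^ 2)
      = slope c x * slope c (Real.sigmoid (c * x)) + slope c x *
        (slopeCorr c (Real.sigmoid (c * x)) / (m + 1) + |c| * c ^ 2 / 144 / (m + 1) ^ 2) := by ring
    rw [this, hr]
    linarith
  set N : ℝ := (m : ℝ) + 1 with hN
  have hlog : 1 ≤ Real.log N := by
    rw [Real.le_log_iff_exp_le (by linarith)]
    linarith [Real.exp_one_lt_three]
  refine tau_le_of_tvDist_lt (t := 2 * ⌈3 * Real.log N / (-Real.log r)⌉₊) (fun i => ?_) ?_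
  · refine (tvDist_gibbsK_pow_le hr0.le hcontr _ i).trans_lt ?_
    set t := ⌈3 * Real.log N / (-Real.log r)⌉₊ with ht
    have h1 : 3 * Real.log N ≤ t * (-Real.log r) := (div_le_iff₀ hl).1 (Nat.le_ceil _)
    have h2 : r ^ t = Real.exp (t * Real.log r) := by
      rw [Real.exp_nat_mul, Real.exp_log hr0]
    have h3 : r ^ t ≤ Real.exp (-(3 * Real.log N)) := by
      rw [h2]
      exact Real.exp_le_exp.2 (by linarith)
    have h4 : Real.exp (-(3 * Real.log N)) = (N ^ 3)⁻¹ := by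
      rw [Real.exp_neg, show 3 * Real.log N = ((3 : ℕ) : ℝ) * Real.log N by norm_num,
        Real.exp_nat_mul, Real.exp_log (by linarith)]
    rw [h4] at h3
    calc N * r ^ t ≤ N * (N ^ 3)⁻¹ := mul_le_mul_of_nonneg_left h3 (by linarith)
      _ = 1 / N ^ 2 := by field_simp
      _ < 1 / 4 := by
        apply one_div_lt_one_div_of_lt (by norm_num)
        nlinarith
  · have h1 := (Nat.ceil_lt_add_one (show 0 ≤ 3 * Real.log N / (-Real.log r) by positivity)).le
    push_cast
    calc 2 * (⌈3 * Real.log N / (-Real.log r)⌉₊ : ℝ)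
        ≤ 2 * (3 * Real.log N / (-Real.log r) + 1) := by linarith
      _ = 6 / (-Real.log r) * Real.log N + 2 := by ring
      _ ≤ (6 / (-Real.log r) + 2) * Real.log N := by linarith

/-- A perturbation of order `1 / n` which is negative where the leading term attains its maximum
`1` keeps the sum below `1` by a margin of order `1 / n`. -/
theorem exists_add_div_le_one_sub {h₁ h₂ : ℝ → ℝ} (c₁ : Continuous h₁) (c₂ : Continuous h₂)
    {p₀ : ℝ} (hp₀ : h₂ p₀ < 0) (hle : ∀ p ∈ Set.Icc (0 : ℝ) 1, h₁ p ≤ 1)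
    (hlt : ∀ p ∈ Set.Icc (0 : ℝ) 1, p ≠ p₀ → h₁ p < 1) :
    ∃ κ > 0, ∃ N₀ : ℝ, ∀ n : ℝ, N₀ ≤ n → 0 < n → ∀ p ∈ Set.Icc (0 : ℝ) 1,
      h₁ p + h₂ p / n ≤ 1 - κ / n := by
  obtain ⟨B, hB⟩ := isCompact_Icc.exists_bound_of_continuousOn
    (c₂.continuousOn (s := Set.Icc (0 : ℝ) 1))
  -- Where h₂ < -ν the perturbation itself supplies the margin. The rest is a compact set avoiding
  -- p₀, on which h₁ stays away from 1 and the perturbation is negligible for large n.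
  set ν := -h₂ p₀ / 2 with hν
  have hν0 : 0 < ν := by linarith
  have hS : IsCompact (Set.Icc (0 : ℝ) 1 ∩ {p | -ν ≤ h₂ p}) :=
    isCompact_Icc.inter_right (isClosed_le continuous_const c₂)
  obtain ⟨δ, hδ0, hδ⟩ : ∃ δ > 0, ∀ p ∈ Set.Icc (0 : ℝ) 1 ∩ {p | -ν ≤ h₂ p}, h₁ p ≤ 1 - δ := by
    rcases (Set.Icc (0 : ℝ) 1 ∩ {p | -ν ≤ h₂ p}).eq_empty_or_nonempty with he | hne
    · exact ⟨1, one_pos, fun p hp => by rw [he] at hp; exact hp.elim⟩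
    · obtain ⟨q, hq, hmax⟩ := hS.exists_isMaxOn hne c₁.continuousOn
      have hq1 : h₁ q < 1 := hlt q hq.1 (by
        rintro rfl
        have := hq.2
        simp only [Set.mem_ofPred_eq] at this
        linarith)
      exact ⟨1 - h₁ q, by linarith, fun p hp => by
        have : h₁ p ≤ h₁ q := hmax hp
        linarith⟩
  refine ⟨ν, hν0, (B + ν) / δ, fun n hn hn0 p hp => ?_⟩
  by_cases h : -ν ≤ h₂ p
  · have h1 := hδ p ⟨hp, h⟩
    have h2 := (le_abs_self _).trans (hB p hp)
    rw [div_le_iff₀ hδ0] at hn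
    have h3 : h₂ p / n ≤ B / n := by gcongr
    have h4 : (B + ν) / n ≤ δ := by
      rw [div_le_iff₀ hn0]
      linarith
    rw [add_div] at h4
    linarith
  · have h1 := hle p hp
    have h3 : h₂ p / n ≤ -ν / n := div_le_div_of_nonneg_right (not_le.1 h).le hn0.le
    rw [neg_div] at h3
    linarith

/-- Polynomial mixing at the critical value. -/
theorem exists_tau_critical_le {u : ℝ} (hu1 : 1 < u) (hu : (u - 1) * Real.exp u = 1)
    (hlo : 5.865 < 1 + u + Real.exp u) (hhi : 1 + u + Real.exp u < 5.875) :
    ∃ C : ℝ, ∀ᶠ n : ℕ in atTop,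
      (tau (-1 - u - Real.exp u) n : ℝ≥0∞) ≤ ENNReal.ofReal (C * (n : ℝ) ^ 5) := by
  set E := Real.exp u with hE
  have hEpos : 0 < E := Real.exp_pos u
  have hu0 : 0 < u := by linarith
  have huE : u * E = 1 + E := by linarith
  set a := 1 + u + E with ha
  have ha0 : 0 < a := by linarith
  have hau : a = u * (1 + E) := by linarith
  set c := -1 - u - E with hc
  have hca : c = -a := by linarith
  have habs : |c| = a := by rw [hca, abs_neg, abs_of_pos ha0]
  set p₀ := 1 / (1 + E) with hp₀
  have hp₀a : a * p₀ = u := by rw [hau, hp₀]; field_simp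
  have hvar : a * (p₀ * (1 - p₀)) = 1 := by
    rw [← mul_assoc, hp₀a, hp₀]
    field_simp
    linarith
  have hfix : Real.sigmoid (c * p₀) = p₀ := by
    rw [hca, neg_mul, hp₀a, Real.sigmoid_neg, sigmoid_eq_exp_div, ← hE, hp₀]
    field_simp
    ring
  let h₁ : ℝ → ℝ := fun p => c ^ 2 * (p * (1 - p))
    * (Real.sigmoid (c * p) * (1 - Real.sigmoid (c * p)))
  let h₂ : ℝ → ℝ := fun p => a * (p * (1 - p)) * slopeCorr c p
  have hcs : Continuous fun p => Real.sigmoid (c * p) :=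
    continuous_sigmoid.comp (continuous_const.mul continuous_id)
  have c₁ : Continuous h₁ := by
    simp only [h₁]
    fun_prop
  have c₂ : Continuous h₂ := by
    have := continuous_slopeCorr c
    simp only [h₂]
    fun_prop
  have hneg : h₂ p₀ < 0 := by
    simp only [h₂]
    rw [hvar, one_mul, slopeCorr, hfix, habs, hca]
    -- Using a p₀(1 - p₀) = 1, the correction at the fixed point depends on a alone. The quadratic
    -- has roots 12 ± 4√3, and a ≈ 5.87 lies between them.
    have e1 : a * -a * (p₀ * (1 - p₀) * (1 - 2 * p₀)) * (1 / 2 - p₀)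
        + a * (-a) ^ 2 / 48 * (p₀ * (1 - p₀)) = (a ^ 2 - 24 * a + 96) / 48 := by
      linear_combination (-a * (1 - 2 * p₀) ^ 2 / 2 + a ^ 2 / 48 + 2) * hvar
    rw [e1]
    nlinarith
  have hlt : ∀ p ∈ Set.Icc (0 : ℝ) 1, p ≠ p₀ → h₁ p < 1 := by
    intro p hp hne
    have h := mul_sub_mul_sigmoid_deriv_lt_one (v := a * p) hu1 hu (mul_nonneg ha0.le hp.1)
      (fun h => hne (by
        rw [← hp₀a] at h
        exact mul_left_cancel₀ ha0.ne' h))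
    rw [← hE, ← ha] at h
    refine lt_of_eq_of_lt ?_ h
    simp only [h₁]
    rw [hca, neg_mul, sigmoid_deriv_neg]
    ring
  have hle : ∀ p ∈ Set.Icc (0 : ℝ) 1, h₁ p ≤ 1 := by
    intro p hp
    by_cases hne : p = p₀
    · rw [hne]
      simp only [h₁]
      rw [hfix, hca]
      apply le_of_eq
      linear_combination (a * (p₀ * (1 - p₀)) + 1) * hvar
    · exact (hlt p hp hne).le
  obtain ⟨κ, hκ, N₀, hN₀⟩ := exists_add_div_le_one_sub c₁ c₂ hneg hle hlt
  -- With ρ = 1 - κ/(2n), n² double steps leave n e^{-κn/2} → 0, so the time is 2n² ≤ 2n⁵.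
  refine ⟨2, ?_⟩
  have hev : Tendsto (fun n : ℕ => (n : ℝ) * Real.exp (-(κ / 2 * n))) atTop (nhds 0) := by
    have h1 := (Real.tendsto_pow_mul_exp_neg_atTop_nhds_zero 1).comp
      (tendsto_natCast_atTop_atTop.const_mul_atTop (show 0 < κ / 2 by positivity))
    have h2 := h1.const_mul (κ / 2)⁻¹
    rw [mul_zero] at h2
    refine h2.congr fun n => ?_
    simp only [Function.comp, pow_one]
    field_simp
  -- Bounds the n^{-2} remainder, which for large n uses up only half of the margin κ/n.
  set W := a / 4 * (a * c ^ 2 / 144) with hW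
  have hW0 : 0 ≤ W := by positivity
  filter_upwards [eventually_ge_atTop 1, eventually_ge_atTop ⌈N₀⌉₊,
    eventually_ge_atTop ⌈κ⌉₊, eventually_ge_atTop ⌈W / (κ / 2)⌉₊,
    hev.eventually (gt_mem_nhds (show (0 : ℝ) < 1 / 4 by norm_num))] with n hn1 hnN hnκ hnW hexp
  obtain ⟨m, rfl⟩ : ∃ m, n = m + 1 := ⟨n - 1, by omega⟩
  have hN1 : N₀ ≤ (m : ℝ) + 1 := by
    have := (Nat.le_ceil N₀).trans (Nat.cast_le.2 hnN)
    push_cast at this; exact this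
  have hN2 : κ ≤ (m : ℝ) + 1 := by
    have := (Nat.le_ceil κ).trans (Nat.cast_le.2 hnκ)
    push_cast at this; exact this
  have hN3 : W / (κ / 2) ≤ (m : ℝ) + 1 := by
    have := (Nat.le_ceil (W / (κ / 2))).trans (Nat.cast_le.2 hnW)
    push_cast at this; exact this
  push_cast at hexp
  have hnn : (1 : ℝ) ≤ (m : ℝ) + 1 := by linarith [(Nat.cast_nonneg m : (0 : ℝ) ≤ m)]
  set N : ℝ := (m : ℝ) + 1 with hN
  have hNpos : 0 < N := by linarith
  have hcontr : ∀ x ∈ Set.Icc (0 : ℝ) 1, slope c x * (slope c (Real.sigmoid (c * x))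
      + slopeCorr c (Real.sigmoid (c * x)) / N + |c| * c ^ 2 / 144 / N ^ 2)
      ≤ 1 - κ / 2 / N := by
    intro x hx
    have h1 := hN₀ N hN1 hNpos _ (sigmoid_mem_Icc (c * x))
    have h2 : slope c x * (|c| * c ^ 2 / 144 / N ^ 2) ≤ κ / 2 / N := by
      have h3 : slope c x * (|c| * c ^ 2 / 144) ≤ W := by
        rw [hW, ← habs]
        exact mul_le_mul_of_nonneg_right (slope_le c x) (by positivity)
      rw [← mul_div_assoc, div_le_div_iff₀ (by positivity) hNpos]
      rw [div_le_iff₀ (by positivity)] at hN3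
      nlinarith
    have h3 : slope c x * (slope c (Real.sigmoid (c * x))
        + slopeCorr c (Real.sigmoid (c * x)) / N)
        = h₁ (Real.sigmoid (c * x)) + h₂ (Real.sigmoid (c * x)) / N := by
      rw [mul_add, slope_mul_slope, ← mul_div_assoc]
      simp only [h₁, h₂, slope, habs]
    have h4 : κ / N = κ / 2 / N + κ / 2 / N := by ring
    rw [mul_add, h3]
    linarith
  have hr0 : 0 ≤ 1 - κ / 2 / N := by
    have : κ / 2 / N ≤ 1 := by rw [div_le_one hNpos]; linarith
    linarith
  refine tau_le_of_tvDist_lt (t := 2 * (m + 1) ^ 2) (fun i => ?_) ?_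
  · refine (tvDist_gibbsK_pow_le hr0 hcontr _ i).trans_lt (lt_of_le_of_lt ?_ hexp)
    refine mul_le_mul_of_nonneg_left ?_ hNpos.le
    have h1 : 1 - κ / 2 / N ≤ Real.exp (-(κ / 2 / N)) := by
      linarith [Real.add_one_le_exp (-(κ / 2 / N))]
    refine (pow_le_pow_left₀ hr0 h1 _).trans (le_of_eq ?_)
    rw [← Real.exp_nat_mul]
    congr 1
    push_cast
    rw [← hN]
    field_simp
  · push_cast
    have : N ^ 2 ≤ N ^ 5 := pow_le_pow_right₀ hnn (by norm_num)
    linarith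

/-! ### Concentration around the two-step map and moving traps -/

theorem abs_sigmoid_mul_sub_le_lipschitz (c x y : ℝ) :
    |Real.sigmoid (c * y) - Real.sigmoid (c * x)| ≤ |c| / 4 * |y - x| := by
  have h := convex_univ.norm_image_sub_le_of_norm_hasDerivWithin_le
    (f := fun x => Real.sigmoid (c * x)) (C := |c| / 4) (x := x) (y := y)
    (fun z _ => (hasDerivAt_sigmoid_mul c z).hasDerivWithinAt) (fun z _ => by
      have h1 := slope_le c z
      rw [slope] at h1
      rwa [Real.norm_eq_abs, abs_mul, abs_of_nonneg (a := _ * _)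
        (mul_nonneg (Real.sigmoid_nonneg _) (sub_nonneg.2 (Real.sigmoid_le_one _)))])
    trivial trivial
  simpa only [Real.norm_eq_abs] using h

/-- Allowing g to be negative admits q - τ, where q is the next-step escape probability and is only
known to be at most τ near the mean. -/
theorem gibbsK_tail {c : ℝ} {n : ℕ} (hn : 1 ≤ n) {η : ℝ} (hη0 : 0 ≤ η) (hη : η ≤ 1)
    (i : Fin (n + 1)) {g : Fin (n + 1) → ℝ} (hg1 : ∀ j, g j ≤ 1)
    (hg0 : ∀ j, |pt n j - Real.sigmoid (c * pt n i)| < η → g j ≤ 0) :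
    ∑ j, gibbsK c n i j * g j ≤ 2 * Real.exp (-(n * η ^ 2 / 4)) := by
  have hp := sigmoid_mem_Icc (c * pt n i)
  let h : ℕ → ℝ := fun k => if |(k : ℝ) / n - Real.sigmoid (c * pt n i)| < η then 0 else 1
  refine le_trans ?_ (binE_tail_two_sided hn hp.1 hp.2 hη0 hη (g := h)
    (fun k => by simp only [h]; split_ifs <;> norm_num) (fun k hk => by simp only [h, if_pos hk, le_refl]))
  have e := sum_gibbsK_mul c n h i
  rw [gibbsStep] at e
  rw [pt, ← e]
  refine Finset.sum_le_sum fun j _ => mul_le_mul_of_nonneg_left ?_ ((isProb_gibbsK c n i).1 j)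
  simp only [h]
  split_ifs with hj
  · exact hg0 j hj
  · exact hg1 j

/-- Two steps of the chain follow the two-step deterministic map up to an exponentially small
probability. -/
theorem sum_compl_gibbsK_sq_le {c : ℝ} {n : ℕ} (hn : 1 ≤ n) {η : ℝ} (hη0 : 0 ≤ η) (hη : η ≤ 1)
    (i : Fin (n + 1)) (S : Finset (Fin (n + 1)))
    (hS : ∀ y, |pt n y - Real.sigmoid (c * Real.sigmoid (c * pt n i))| ≤ (|c| / 4 + 1) * η → y ∈ S) :
    ∑ y ∈ Sᶜ, (gibbsK c n ^ 2) i y ≤ 4 * Real.exp (-(n * η ^ 2 / 4)) := by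
  set τ := 2 * Real.exp (-(n * η ^ 2 / 4)) with hτ
  have hτ0 : 0 ≤ τ := by positivity
  let q : Fin (n + 1) → ℝ := fun j => ∑ y ∈ Sᶜ, gibbsK c n j y
  have h1 : ∑ y ∈ Sᶜ, (gibbsK c n ^ 2) i y = ∑ j, gibbsK c n i j * q j := by
    simp only [sq, Matrix.mul_apply, q, Finset.mul_sum]
    rw [Finset.sum_comm]
  have hq1 : ∀ j, q j ≤ 1 := fun j => by
    rw [← (isProb_gibbsK c n j).2]
    exact Finset.sum_le_sum_of_subset_of_nonneg (Finset.subset_univ _)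
      fun y _ _ => (isProb_gibbsK c n j).1 y
  have hq2 : ∀ j, |pt n j - Real.sigmoid (c * pt n i)| < η → q j ≤ τ := fun j hj => by
    have e : q j = ∑ y, gibbsK c n j y * (if y ∈ S then 0 else 1) := by
      simp only [q, mul_ite, mul_zero, mul_one]
      rw [Finset.sum_ite, Finset.sum_const_zero, zero_add]
      refine Finset.sum_congr ?_ fun _ _ => rfl
      ext y
      simp
    rw [e]
    refine gibbsK_tail hn hη0 hη j (fun y => by split_ifs <;> norm_num) fun y hy => ?_
    rw [if_pos]
    refine hS y ?_
    have h2 := abs_sigmoid_mul_sub_le_lipschitz c (Real.sigmoid (c * pt n i)) (pt n j)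
    have h3 : |c| / 4 * |pt n j - Real.sigmoid (c * pt n i)| ≤ |c| / 4 * η :=
      mul_le_mul_of_nonneg_left hj.le (by positivity)
    have h4 := abs_sub_le (pt n y) (Real.sigmoid (c * pt n j))
      (Real.sigmoid (c * Real.sigmoid (c * pt n i)))
    linarith
  have h2 : ∑ j, gibbsK c n i j * (q j - τ) ≤ τ :=
    gibbsK_tail hn hη0 hη i (fun j => by linarith [hq1 j]) fun j hj => by linarith [hq2 j hj]
  simp only [mul_sub, Finset.sum_sub_distrib] at h2
  rw [← Finset.sum_mul, (isProb_gibbsK c n i).2, one_mul] at h2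
  rw [h1]
  linarith

theorem monotone_two_step {c : ℝ} (hc : c ≤ 0) :
    Monotone fun x => Real.sigmoid (c * Real.sigmoid (c * x)) := fun _ _ h =>
  Real.sigmoid_le (mul_le_mul_of_nonpos_left
    (Real.sigmoid_le (mul_le_mul_of_nonpos_left h hc)) hc)

/-- Moving thresholds which the two-step map, perturbed by the noise level `η`, does not cross
give a lower bound for the mixing time. -/
theorem le_tau_of_thresholds {c : ℝ} (hc : c ≤ 0) {n : ℕ} (hn : 1 ≤ n) {η : ℝ} (hη0 : 0 ≤ η)
    (hη : η ≤ 1) (T : ℕ) (a b : ℕ → ℝ)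
    (ha : ∀ k < T, Real.sigmoid (c * Real.sigmoid (c * a k)) + (|c| / 4 + 1) * η ≤ a (k + 1))
    (hb : ∀ k < T, b (k + 1) ≤ Real.sigmoid (c * Real.sigmoid (c * b k)) - (|c| / 4 + 1) * η)
    (ha0 : 0 ≤ a 0) (hb0 : b 0 ≤ 1) (hab : a T < b T)
    (hT : T * (4 * Real.exp (-(n * η ^ 2 / 4))) ≤ 1 / 4) :
    ((2 * T + 1 : ℕ) : ℕ∞) ≤ tau c n := by
  have hn' : (n : ℝ) ≠ 0 := by positivity
  have hmono := monotone_two_step hc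
  refine le_mixingTime_of_two_traps (isProb_gibbsK c n) (isStationary_gibbsPi c n)
    (by positivity) (fun k => Finset.univ.filter fun x => pt n x ≤ a k)
    (fun k => Finset.univ.filter fun x => b k ≤ pt n x) T ?_ ?_ (x₀ := 0) (y₀ := Fin.last n)
    ?_ ?_ ?_ hT
  · intro k hk x hx
    refine sum_compl_gibbsK_sq_le hn hη0 hη x _ fun y hy => ?_
    rw [Finset.mem_filter] at hx ⊢
    refine ⟨Finset.mem_univ _, ?_⟩
    have h1 := hmono hx.2
    simp only at h1
    linarith [(abs_le.1 hy).2, ha k hk]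
  · intro k hk x hx
    refine sum_compl_gibbsK_sq_le hn hη0 hη x _ fun y hy => ?_
    rw [Finset.mem_filter] at hx ⊢
    refine ⟨Finset.mem_univ _, ?_⟩
    have h1 := hmono hx.2
    simp only at h1
    linarith [(abs_le.1 hy).1, hb k hk]
  · exact Finset.mem_filter.2 ⟨Finset.mem_univ _, by simpa [pt] using ha0⟩
  · exact Finset.mem_filter.2 ⟨Finset.mem_univ _, by simpa [pt, hn'] using hb0⟩
  · rw [Finset.disjoint_left]
    intro x hx hy
    rw [Finset.mem_filter] at hx hy
    linarith [hx.2, hy.2]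

theorem ofReal_le_tau {c : ℝ} {n T : ℕ} {r : ℝ} (h : ((T : ℕ) : ℕ∞) ≤ tau c n) (hr : r ≤ T) :
    ENNReal.ofReal r ≤ (tau c n : ℝ≥0∞) := by
  have h1 : (((T : ℕ) : ℕ∞) : ℝ≥0∞) ≤ (tau c n : ℝ≥0∞) := ENat.toENNReal_le.2 h
  rw [ENat.toENNReal_coe] at h1
  refine le_trans ?_ h1
  rw [← ENNReal.ofReal_natCast]
  exact ENNReal.ofReal_le_ofReal hr

/-! ### The repelling fixed point below the critical value -/

theorem hasDerivAt_two_step (c x : ℝ) :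
    HasDerivAt (fun x => Real.sigmoid (c * Real.sigmoid (c * x)))
      (slope c x * slope c (Real.sigmoid (c * x))) x := by
  have h := HasDerivAt.comp x (h₂ := fun y => Real.sigmoid (c * y))
    (hasDerivAt_sigmoid_mul c (Real.sigmoid (c * x))) (hasDerivAt_sigmoid_mul c x)
  refine h.congr_deriv ?_
  rw [slope_mul_slope]
  ring

/-- The fixed point of `x ↦ σ (c x)` for `c = - s (1 + exp s)`. -/
theorem sigmoid_fixed_point {s c : ℝ} (hc : c = -(s * (1 + Real.exp s))) :
    Real.sigmoid (c * (1 / (1 + Real.exp s))) = 1 / (1 + Real.exp s) := by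
  have h := Real.exp_pos s
  have e : c * (1 / (1 + Real.exp s)) = -s := by rw [hc]; field_simp
  rw [e, Real.sigmoid_neg, sigmoid_eq_exp_div]
  field_simp
  ring

theorem slope_fixed_point {s c : ℝ} (hs : 0 ≤ s) (hc : c = -(s * (1 + Real.exp s))) :
    slope c (1 / (1 + Real.exp s)) = s * Real.exp s / (1 + Real.exp s) := by
  have h := Real.exp_pos s
  rw [slope, sigmoid_fixed_point hc, hc, abs_neg, abs_of_nonneg (by positivity)]
  field_simp
  ring

/-- Exponentially slow mixing below the critical value. -/
theorem exists_exp_le_tau {u c : ℝ} (hu1 : 1 < u) (hu : (u - 1) * Real.exp u = 1)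
    (hc : c < -1 - u - Real.exp u) :
    ∃ ψ : ℝ, 0 < ψ ∧ ∀ n : ℕ, 1 ≤ n →
      ENNReal.ofReal (Real.exp (ψ * n) / 8) ≤ (tau c n : ℝ≥0∞) := by
  have hc0 : c < 0 := by have := Real.exp_pos u; linarith
  obtain ⟨s, hus, hs⟩ : ∃ s, u < s ∧ c = -(s * (1 + Real.exp s)) := by
    have hcont : ContinuousOn (fun s : ℝ => s * (1 + Real.exp s)) (Set.Icc u (-c)) := by fun_prop
    have huc : u ≤ -c := by have := Real.exp_pos u; linarith
    obtain ⟨s, hs, he⟩ := intermediate_value_Ioo huc hcont (show -c ∈ Set.Ioo _ _ from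
      ⟨by linarith, by
        have := Real.exp_pos (-c)
        nlinarith⟩)
    exact ⟨s, hs.1, by linarith⟩
  have hs0 : 0 < s := by linarith
  have hexp := Real.exp_pos s
  set x₀ := 1 / (1 + Real.exp s) with hx₀
  have hfix : Real.sigmoid (c * x₀) = x₀ := sigmoid_fixed_point hs
  have hx0 : 0 < x₀ := by positivity
  have hx1 : x₀ < 1 := by rw [hx₀, div_lt_one (by positivity)]; linarith
  have hψ : 1 < slope c x₀ := by
    rw [slope_fixed_point hs0.le hs, one_lt_div (by positivity)]
    have := strictMonoOn_sub_one_mul_exp (Set.mem_Ici.2 hu1.le)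
      (Set.mem_Ici.2 (hu1.trans hus).le) hus
    simp only [hu] at this
    linarith
  have hd := hasDerivAt_two_step c x₀
  rw [hfix] at hd
  rw [hasDerivAt_iff_tendsto_slope] at hd
  have hev := hd.eventually (lt_mem_nhds (show 1 < slope c x₀ * slope c x₀ by nlinarith))
  rw [eventually_nhdsWithin_iff, Metric.eventually_nhds_iff] at hev
  obtain ⟨ε, hε, hev⟩ := hev
  -- Close enough to x₀ that the difference quotient of Φ exceeds 1, while x₀ ± y stay in [0, 1];
  -- the thresholds are then constant in time.
  set y := min (ε / 2) (min x₀ (1 - x₀)) with hy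
  have hy0 : 0 < y := lt_min (by linarith) (lt_min hx0 (by linarith))
  have hy1 : y ≤ ε / 2 := min_le_left _ _
  have hy2 : y ≤ x₀ := (min_le_right _ _).trans (min_le_left _ _)
  have hy3 : y ≤ 1 - x₀ := (min_le_right _ _).trans (min_le_right _ _)
  have hG0 : Real.sigmoid (c * Real.sigmoid (c * x₀)) = x₀ := by rw [hfix, hfix]
  have hup : x₀ + y < Real.sigmoid (c * Real.sigmoid (c * (x₀ + y))) := by
    have h := hev (y := x₀ + y) (by rw [Real.dist_eq, add_sub_cancel_left, abs_of_pos hy0]; linarith)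
      (by simp [hy0.ne'])
    rw [slope_def_field, hG0, add_sub_cancel_left, lt_div_iff₀ hy0] at h
    linarith
  have hdown : Real.sigmoid (c * Real.sigmoid (c * (x₀ - y))) < x₀ - y := by
    have h := hev (y := x₀ - y) (by
      rw [Real.dist_eq, sub_sub_cancel_left, abs_neg, abs_of_pos hy0]; linarith)
      (by simp [hy0.ne'])
    rw [slope_def_field, hG0, sub_sub_cancel_left, lt_div_iff_of_neg (by linarith)] at h
    linarith
  obtain ⟨L, hL⟩ : ∃ L, L = |c| / 4 + 1 := ⟨_, rfl⟩
  have hL0 : 0 < L := by rw [hL]; positivity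
  set η := min 1 (min ((Real.sigmoid (c * Real.sigmoid (c * (x₀ + y))) - (x₀ + y)) / L)
    ((x₀ - y - Real.sigmoid (c * Real.sigmoid (c * (x₀ - y)))) / L)) with hη
  have hη0 : 0 < η := lt_min one_pos (lt_min (div_pos (by linarith) hL0) (div_pos (by linarith) hL0))
  have hη1 : η ≤ 1 := min_le_left _ _
  have hη2 : L * η ≤ Real.sigmoid (c * Real.sigmoid (c * (x₀ + y))) - (x₀ + y) := by
    have : η ≤ (Real.sigmoid (c * Real.sigmoid (c * (x₀ + y))) - (x₀ + y)) / L :=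
      (min_le_right _ _).trans (min_le_left _ _)
    rw [le_div_iff₀ hL0] at this
    linarith
  have hη3 : L * η ≤ x₀ - y - Real.sigmoid (c * Real.sigmoid (c * (x₀ - y))) := by
    have : η ≤ (x₀ - y - Real.sigmoid (c * Real.sigmoid (c * (x₀ - y)))) / L :=
      (min_le_right _ _).trans (min_le_right _ _)
    rw [le_div_iff₀ hL0] at this
    linarith
  refine ⟨η ^ 2 / 8, by positivity, fun n hn => ?_⟩
  set X := Real.exp (η ^ 2 / 8 * n) with hX
  have hXpos : 0 < X := Real.exp_pos _
  have hX2 : Real.exp (-(n * η ^ 2 / 4)) = (X ^ 2)⁻¹ := by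
    rw [hX, ← Real.exp_nat_mul, ← Real.exp_neg]
    congr 1
    push_cast
    ring
  -- The longest time the union bound T · 4X^{-2} ≤ 1/4 permits. Claiming only X/8 leaves room for
  -- the floor when X > 8; when X ≤ 8 the final + 1 is enough.
  set T := ⌊X ^ 2 / 16⌋₊ with hT
  have hT1 : (T : ℝ) ≤ X ^ 2 / 16 := Nat.floor_le (by positivity)
  have hT2 : X ^ 2 / 16 < T + 1 := Nat.lt_floor_add_one _
  refine ofReal_le_tau (le_tau_of_thresholds hc0.le hn hη0.le hη1 T (fun _ => x₀ - y)
    (fun _ => x₀ + y) (fun k _ => by rw [← hL]; linarith) (fun k _ => by rw [← hL]; linarith) (by linarith)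
    (by linarith) (by linarith) ?_) ?_
  · rw [hX2]
    calc (T : ℝ) * (4 * (X ^ 2)⁻¹) ≤ X ^ 2 / 16 * (4 * (X ^ 2)⁻¹) :=
          mul_le_mul_of_nonneg_right hT1 (by positivity)
      _ = 1 / 4 := by field_simp; norm_num
  · push_cast
    have : (0 : ℝ) ≤ T := Nat.cast_nonneg T
    by_cases h8 : X ≤ 8
    · linarith
    · nlinarith

/-! ### The marginal fixed point at the critical value -/

theorem abs_slope_sub_le (c x y : ℝ) : |slope c y - slope c x| ≤ c ^ 2 * |y - x| := by
  have hd : ∀ z, HasDerivAt (slope c) (|c| * (Real.sigmoid (c * z) * (1 - Real.sigmoid (c * z))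
      * (1 - 2 * Real.sigmoid (c * z)) * c)) z := fun z => by
    have h := ((hasDerivAt_sigmoid_deriv (c * z)).comp z ((hasDerivAt_id z).const_mul c)).const_mul |c|
    refine h.congr_deriv ?_
    ring
  have h := convex_univ.norm_image_sub_le_of_norm_hasDerivWithin_le
    (f := slope c) (C := c ^ 2) (x := x) (y := y)
    (fun z _ => (hd z).hasDerivWithinAt) (fun z _ => by
      have hs := sigmoid_mem_Icc (c * z)
      set p := Real.sigmoid (c * z) with hp
      have h1 : |p * (1 - p) * (1 - 2 * p)| ≤ 1 := by
        have h2 : |p * (1 - p)| ≤ 1 := by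
          rw [abs_le]; constructor <;> nlinarith [hs.1, hs.2, mul_nonneg hs.1 (sub_nonneg.2 hs.2)]
        have h3 : |1 - 2 * p| ≤ 1 := by
          rw [abs_le]; constructor <;> linarith [hs.1, hs.2]
        rw [abs_mul]
        exact mul_le_one₀ h2 (abs_nonneg _) h3
      rw [Real.norm_eq_abs, abs_mul, abs_abs, abs_mul, ← sq_abs c]
      nlinarith [mul_le_mul_of_nonneg_right h1 (sq_nonneg |c|)])
    trivial trivial
  simpa only [Real.norm_eq_abs] using h

/-- If the fixed point is marginal then the two-step map is quadratically close to the identity. -/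
theorem exists_abs_two_step_sub_le {c x₀ : ℝ} (hfix : Real.sigmoid (c * x₀) = x₀)
    (hs : slope c x₀ = 1) :
    ∃ C : ℝ, 0 ≤ C ∧ ∀ x, |Real.sigmoid (c * Real.sigmoid (c * x)) - x| ≤ C * (x - x₀) ^ 2 := by
  refine ⟨|c| / 4 * (c ^ 2 * (|c| / 4)) + c ^ 2, by positivity, fun x => ?_⟩
  set C := |c| / 4 * (c ^ 2 * (|c| / 4)) + c ^ 2 with hC
  have hC0 : 0 ≤ C := by positivity
  have hder : ∀ z, |slope c z * slope c (Real.sigmoid (c * z)) - 1| ≤ C * |z - x₀| := by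
    intro z
    have h1 := abs_slope_sub_le c x₀ z
    have h2 := abs_slope_sub_le c x₀ (Real.sigmoid (c * z))
    have h3 := abs_sigmoid_mul_sub_le_lipschitz c x₀ z
    rw [hfix] at h3
    rw [hs] at h1 h2
    have e : slope c z * slope c (Real.sigmoid (c * z)) - 1
        = slope c z * (slope c (Real.sigmoid (c * z)) - 1) + (slope c z - 1) := by ring
    rw [e]
    refine (abs_add_le _ _).trans ?_
    rw [abs_mul, abs_of_nonneg (slope_nonneg c z), hC, add_mul]
    refine add_le_add ?_ h1
    rw [mul_assoc]
    refine mul_le_mul (slope_le c z) ?_ (abs_nonneg _) (by positivity)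
    refine h2.trans ?_
    rw [mul_assoc]
    exact mul_le_mul_of_nonneg_left h3 (sq_nonneg c)
  have h := (convex_uIcc x₀ x).norm_image_sub_le_of_norm_hasDerivWithin_le
    (f := fun x => Real.sigmoid (c * Real.sigmoid (c * x)) - x) (C := C * |x - x₀|)
    (fun z _ => ((hasDerivAt_two_step c z).sub (hasDerivAt_id z)).hasDerivWithinAt)
    (fun z hz => by
      rw [Real.norm_eq_abs]
      exact (hder z).trans (mul_le_mul_of_nonneg_left (Set.abs_sub_left_of_mem_uIcc hz) hC0))
    Set.left_mem_uIcc Set.right_mem_uIcc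
  simp only [Real.norm_eq_abs, hfix, sub_self, sub_zero] at h
  rw [mul_assoc, ← sq, sq_abs] at h
  exact h

/-- Lower bound near a marginal fixed point, for explicit window `δ` and noise level `η`. -/
theorem le_tau_of_marginal {c x₀ C : ℝ} (hc : c ≤ 0) (hC0 : 0 ≤ C)
    (hC : ∀ x, |Real.sigmoid (c * Real.sigmoid (c * x)) - x| ≤ C * (x - x₀) ^ 2)
    {n : ℕ} (hn : 1 ≤ n) {δ η : ℝ} (hδ0 : 0 < δ) (hδ1 : 2 * δ ≤ x₀) (hδ2 : 2 * δ ≤ 1 - x₀)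
    (hη0 : 0 ≤ η) (hη1 : η ≤ 1) {T : ℕ}
    (hT : T * (4 * C * δ ^ 2 + (|c| / 4 + 1) * η) ≤ δ)
    (hT' : T * (4 * Real.exp (-(n * η ^ 2 / 4))) ≤ 1 / 4) :
    ((2 * T + 1 : ℕ) : ℕ∞) ≤ tau c n := by
  obtain ⟨w, hw⟩ : ∃ w, w = (|c| / 4 + 1) * η := ⟨_, rfl⟩
  have hw0 : 0 ≤ w := by rw [hw]; positivity
  rw [← hw] at hT
  obtain ⟨s, hs⟩ : ∃ s, s = 4 * C * δ ^ 2 + w := ⟨_, rfl⟩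
  have hs0 : 0 ≤ s := by rw [hs]; positivity
  rw [← hs] at hT
  have hks : ∀ k < T, 0 ≤ k * s ∧ k * s ≤ δ := fun k hk =>
    ⟨by positivity, le_trans (mul_le_mul_of_nonneg_right (by exact_mod_cast hk.le) hs0) hT⟩
  -- The thresholds start at distance 2δ from x₀ and approach it by s per double step, where s
  -- dominates drift plus noise. Since Ts ≤ δ, they stay at distance at least δ and never meet.
  refine le_tau_of_thresholds hc hn hη0 hη1 T
    (fun k => x₀ - (2 * δ - k * s)) (fun k => x₀ + (2 * δ - k * s)) ?_ ?_ ?_ ?_ ?_ hT'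
  · intro k hk
    obtain ⟨k1, k2⟩ := hks k hk
    have h4 := (abs_le.1 (hC (x₀ - (2 * δ - k * s)))).2
    have h5 : C * (x₀ - (2 * δ - k * s) - x₀) ^ 2 ≤ C * (4 * δ ^ 2) :=
      mul_le_mul_of_nonneg_left (by nlinarith) hC0
    rw [← hw]
    push_cast
    linarith
  · intro k hk
    obtain ⟨k1, k2⟩ := hks k hk
    have h4 := (abs_le.1 (hC (x₀ + (2 * δ - k * s)))).1
    have h5 : C * (x₀ + (2 * δ - k * s) - x₀) ^ 2 ≤ C * (4 * δ ^ 2) :=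
      mul_le_mul_of_nonneg_left (by nlinarith) hC0
    rw [← hw]
    push_cast
    linarith
  · push_cast
    linarith
  · push_cast
    linarith
  · linarith

/-- Polynomially slow mixing at a marginal fixed point. -/
theorem eventually_rpow_le_tau {c x₀ : ℝ} (hc : c ≤ 0) (hfix : Real.sigmoid (c * x₀) = x₀)
    (hs : slope c x₀ = 1) (hx0 : 0 < x₀) (hx1 : x₀ < 1) {γ : ℝ} (hγ0 : 0 < γ) (hγ : γ < 1 / 4) :
    ∀ᶠ n : ℕ in atTop, ENNReal.ofReal (2 * (n : ℝ) ^ γ) ≤ (tau c n : ℝ≥0∞) := by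
  obtain ⟨C, hC0, hC⟩ := exists_abs_two_step_sub_le hfix hs
  -- With δ = n^{-1/4} and η = n^{-1/2+e}, the drift δ² is at most η, nη² = n^{2e} makes the tails
  -- negligible, and n^γ η n^e = δ leaves a factor n^e to absorb constants.
  set e := (1 / 4 - γ) / 2 with he
  have he0 : 0 < e := by linarith
  obtain ⟨L, hL⟩ : ∃ L, L = |c| / 4 + 1 := ⟨_, rfl⟩
  have hL0 : 0 < L := by rw [hL]; positivity
  have t1 : Tendsto (fun n : ℕ => (n : ℝ) ^ (-(1 / 4) : ℝ)) atTop (nhds 0) :=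
    (tendsto_rpow_neg_atTop (by norm_num)).comp tendsto_natCast_atTop_atTop
  have t2 : Tendsto (fun n : ℕ => (n : ℝ) ^ e) atTop atTop :=
    (tendsto_rpow_atTop he0).comp tendsto_natCast_atTop_atTop
  have t3 : Tendsto (fun n : ℕ => ((n : ℝ) ^ (2 * e)) ^ (γ / (2 * e))
      * Real.exp (-(1 / 4) * (n : ℝ) ^ (2 * e))) atTop (nhds 0) :=
    (tendsto_rpow_mul_exp_neg_mul_atTop_nhds_zero (γ / (2 * e)) (1 / 4) (by norm_num)).comp
      ((tendsto_rpow_atTop (by positivity)).comp tendsto_natCast_atTop_atTop)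
  filter_upwards [eventually_ge_atTop 1,
    t1.eventually (gt_mem_nhds (show (0 : ℝ) < min x₀ (1 - x₀) / 2 by
      have : 0 < min x₀ (1 - x₀) := lt_min hx0 (by linarith)
      linarith)),
    t2.eventually_ge_atTop (2 * (4 * C + L)),
    t3.eventually (gt_mem_nhds (show (0 : ℝ) < 1 / 32 by norm_num))] with n hn h1 h2 h3
  have hn1 : (1 : ℝ) ≤ n := by exact_mod_cast hn
  have hn0 : (0 : ℝ) < n := by linarith
  set δ := (n : ℝ) ^ (-(1 / 4) : ℝ) with hδ
  have hδ0 : 0 < δ := Real.rpow_pos_of_pos hn0 _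
  set η := (n : ℝ) ^ (-(1 / 2) + e) with hη
  have hη0 : 0 < η := Real.rpow_pos_of_pos hn0 _
  have hη1 : η ≤ 1 := Real.rpow_le_one_of_one_le_of_nonpos hn1 (by linarith)
  have hδ2 : δ ^ 2 ≤ η := by
    rw [hδ, ← Real.rpow_natCast, ← Real.rpow_mul hn0.le]
    exact Real.rpow_le_rpow_of_exponent_le hn1 (by push_cast; linarith)
  have hηn : n * η ^ 2 / 4 = 1 / 4 * (n : ℝ) ^ (2 * e) := by
    have : (n : ℝ) * η ^ 2 = (n : ℝ) ^ (2 * e) := by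
      rw [hη, ← Real.rpow_natCast, ← Real.rpow_mul hn0.le]
      nth_rewrite 1 [← Real.rpow_one (n : ℝ)]
      rw [← Real.rpow_add hn0]
      congr 1
      push_cast
      ring
    rw [this]
    ring
  set T := ⌈(n : ℝ) ^ γ⌉₊ with hT
  have hγ1 : 1 ≤ (n : ℝ) ^ γ := Real.one_le_rpow hn1 hγ0.le
  have hT1 : (n : ℝ) ^ γ ≤ T := Nat.le_ceil _
  have hT2 : (T : ℝ) ≤ 2 * (n : ℝ) ^ γ := by
    have := (Nat.ceil_lt_add_one (by linarith : 0 ≤ (n : ℝ) ^ γ)).le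
    linarith
  have hmin1 : min x₀ (1 - x₀) ≤ x₀ := min_le_left _ _
  have hmin2 : min x₀ (1 - x₀) ≤ 1 - x₀ := min_le_right _ _
  have hTs : T * (4 * C * δ ^ 2 + L * η) ≤ δ := by
    have e1 : 4 * C * δ ^ 2 + L * η ≤ (4 * C + L) * η := by
      rw [add_mul]
      have := mul_le_mul_of_nonneg_left hδ2 (show 0 ≤ 4 * C by positivity)
      linarith
    have e2 : (n : ℝ) ^ γ * η * (n : ℝ) ^ e = δ := by
      rw [hη, hδ, ← Real.rpow_add hn0, ← Real.rpow_add hn0]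
      congr 1
      rw [he]
      ring
    calc T * (4 * C * δ ^ 2 + L * η) ≤ 2 * (n : ℝ) ^ γ * ((4 * C + L) * η) :=
          mul_le_mul hT2 e1 (by positivity) (by positivity)
      _ = (n : ℝ) ^ γ * η * (2 * (4 * C + L)) := by ring
      _ ≤ (n : ℝ) ^ γ * η * (n : ℝ) ^ e := mul_le_mul_of_nonneg_left h2 (by positivity)
      _ = δ := e2
  rw [hL] at hTs
  refine ofReal_le_tau (le_tau_of_marginal hc hC0 hC hn hδ0 (by linarith) (by linarith) hη0.le hη1
    hTs ?_) (by push_cast; linarith)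
  · have e3 : ((n : ℝ) ^ (2 * e)) ^ (γ / (2 * e)) = (n : ℝ) ^ γ := by
      rw [← Real.rpow_mul hn0.le]
      congr 1
      field_simp
    rw [e3] at h3
    rw [hηn, ← neg_mul]
    have := mul_le_mul_of_nonneg_right hT2 (Real.exp_pos (-(1 / 4) * (n : ℝ) ^ (2 * e))).le
    linarith

end RBM

theorem theorem1 :
    ∃ x_star c_star : ℝ,
      -- `x_star` is the unique real solution of `x e^x / (1 + e^x) = 1`
      (∀ x : ℝ, x * Real.exp x / (1 + Real.exp x) = 1 ↔ x = x_star) ∧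
      |x_star - 1.278| ≤ 0.0005 ∧
      c_star = -1 - x_star - Real.exp x_star ∧
      |c_star - (-5.87)| ≤ 0.005 ∧
      -- fast mixing above the critical value
      (∀ c : ℝ, c_star < c → ∃ C : ℝ, ∀ᶠ n : ℕ in atTop,
        (RBM.tau c n : ℝ≥0∞) ≤ ENNReal.ofReal (C * Real.log n)) ∧
      -- exponentially slow mixing below the critical value
      (∀ c : ℝ, c < c_star → ∃ ψ : ℝ, 0 < ψ ∧ ∀ n : ℕ, 1 ≤ n →
        ENNReal.ofReal (Real.exp (ψ * n) / 8) ≤ (RBM.tau c n : ℝ≥0∞)) ∧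
      -- polynomial lower bound at the critical value
      (∀ γ : ℝ, 0 < γ → γ < 1 / 4 → ∀ᶠ n : ℕ in atTop,
        ENNReal.ofReal (2 * (n : ℝ) ^ γ) ≤ (RBM.tau c_star n : ℝ≥0∞)) ∧
      -- polynomial upper bound at the critical value
      (∃ C : ℝ, ∀ᶠ n : ℕ in atTop,
        (RBM.tau c_star n : ℝ≥0∞) ≤ ENNReal.ofReal (C * (n : ℝ) ^ 5)) := by
  obtain ⟨u, hlo, hhi, hu, ha1, ha2⟩ := RBM.exists_sub_one_mul_exp_eq_one
  have hu1 : 1 < u := by linarith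
  have hexp := Real.exp_pos u
  refine ⟨u, -1 - u - Real.exp u, RBM.mul_exp_div_eq_one_iff hu1 hu, ?_, rfl, ?_, ?_, ?_, ?_,
    RBM.exists_tau_critical_le hu1 hu ha1 ha2⟩
  · rw [abs_le]
    constructor <;> linarith
  · rw [abs_le]
    constructor <;> linarith
  · intro c hc
    obtain ⟨ρ, hρ, h⟩ := RBM.exists_slope_mul_slope_le hu1 hu hc
    exact RBM.exists_tau_le_log hρ h
  · exact fun c hc => RBM.exists_exp_le_tau hu1 hu hc
  · intro γ hγ0 hγ
    have hc : -1 - u - Real.exp u = -(u * (1 + Real.exp u)) := by linarith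
    refine RBM.eventually_rpow_le_tau (by linarith) (RBM.sigmoid_fixed_point hc) ?_ (by positivity)
      ?_ hγ0 hγ
    · rw [RBM.slope_fixed_point (by linarith) hc]
      exact (RBM.mul_exp_div_eq_one_iff hu1 hu u).2 rfl
    · rw [div_lt_one (by positivity)]
      linarith
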